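/- Let $r\in\{3,5,7\}$, let $q\in\mathbb{C}$ be a primitive $r$-th root of unity and put $\mu=1-q^{-2}$. Let $\mathcal{A}$ be the reduced quantum group $\mathbb{C}_q[SL_2]$: the complex algebra generated by the entries of $(t^i{}_j)=\begin{pmatrix}a&b\\c&d\end{pmatrix}$ with relations $$ba=qab,\quad ca=qac,\quad db=qbd,\quad dc=qcd,\quad cb=bc,\quad da-ad=q\mu\, bc,\quad ad-q^{-1}bc=1,$$ $$a^r=d^r=1,\qquad b^r=c^r=0,$$ with the matrix coproduct $\Delta t^i{}_j=\sum_k t^i{}_k\otimes t^k{}_j$ and antipode $Sa=d$, $Sb=-qb$, $Sc=-q^{-1}c$, $Sd=a$. Let $\Lambda^1$ be the vector space with basis $(e_i{}^j)=\begin{pmatrix}e_a&e_b\\e_c&e_d\end{pmatrix}$ (so $e_1{}^2=e_b$), with the left action of $\mathcal{A}$ $$a\triangleright\begin{pmatrix}e_a&e_b\\e_c&e_d\end{pmatrix}=\begin{pmatrix}qe_a+q\mu^2e_d&e_b\\e_c&q^{-1}e_d\end{pmatrix},\qquad b\triangleright\begin{pmatrix}e_a&e_b\\e_c&e_d\end{pmatrix}=\begin{pmatrix}\mu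 e_c&q\mu e_d\\0&0\end{pmatrix},$$ $$c\triangleright\begin{pmatrix}e_a&e_b\\e_c&e_d\end{pmatrix}=\begin{pmatrix}\mu e_b&0\\q\mu e_d&0\end{pmatrix},\qquad d\triangleright\begin{pmatrix}e_a&e_b\\e_c&e_d\end{pmatrix}=\begin{pmatrix}q^{-1}e_a&e_b\\e_c&qe_d\end{pmatrix},$$ and let $\Psi$ be the braiding $\Psi(e_i{}^j\otimes w)=\sum_{k,l}\bigl((St^k{}_i)\,t^j{}_l\triangleright w\bigr)\otimes e_k{}^l$ on $\Lambda^1\otimes\Lambda^1$. Let $\Lambda=T\Lambda^1/\bigoplus_n\ker A_n$, where $A_0=\mathrm{id}$, $A_1=\mathrm{id}$ and $$A_n=(\mathrm{id}\otimes A_{n-1})\bigl(\mathrm{id}-\Psi_{12}+\Psi_{12}\Psi_{23}-\cdots+(-1)^{n-1}\Psi_{12}\Psi_{23}\cdots\Psi_{n-1,n}\bigr).$$ Let $\Omega=\Lambda\otimes\mathcal{A}$ be the exterior algebra of $\mathcal{A}$: the algebra generated by $\Lambda$ and $\mathcal{A}$ with the cross relations $t^i{}_j\,v=\sum_k (t^i{}_k\triangleright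 v)\,t^k{}_j$ for $v\in\Lambda^1$. It is graded by $\Omega^n=\Lambda^n\mathcal{A}$. Put $\theta=e_a+e_d$ and let $\mathrm{d}:\Omega^n\to\Omega^{n+1}$ be $$\mathrm{d}\omega=(-1)^n\,\omega\wedge\theta-\theta\wedge\omega,\qquad \omega\in\Omega^n .$$ Then $\mathrm{d}^2=0$; let $H^n=\ker(\mathrm{d}|_{\Omega^n})/\mathrm{d}(\Omega^{n-1})$ be the noncommutative de Rham cohomology (with $\Omega^{-1}=0$). **Proposition 3.5.** Left multiplication by $\theta$ induces well-defined linear maps $\theta\wedge:H^n\to H^{n+1}$, $[\omega]\mapsto[\theta\wedge\omega]$, whose successive composites vanish (so that the cohomology is itself a complex under $\theta\wedge$), and the sequence $$0\to H^0\xrightarrow{\theta\wedge}H^1\xrightarrow{\theta\wedge}H^2\xrightarrow{\theta\wedge}H^3\xrightarrow{\theta\wedge}H^4\to0$$ is exact. -/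

import Mathlib

namespace QSL2

noncomputable section

/-! ### The crossed module `Λ¹` and its braiding

The basis `e_a, e_b, e_c, e_d` of `Λ¹` is indexed by `0, 1, 2, 3 : Fin 4`. In the two-index notation
`e_i^j` (with `i, j : Fin 2`) these are `e_1^1, e_1^2, e_2^1, e_2^2`. The matrix generators of the
quantum group are `t^1_1 = a`, `t^1_2 = b`, `t^2_1 = c`, `t^2_2 = d`. -/

/-- `μ = 1 - q⁻²`. -/
def mu (q : ℂˣ) : ℂ := 1 - (q : ℂ)⁻¹ ^ 2

/-- `act q i k` is the matrix of the action `t^i_k ▷` on `Λ¹`: the `p`-th column holds the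
coefficients of `t^i_k ▷ e_p`. -/
def act (q : ℂˣ) : Matrix (Fin 2) (Fin 2) (Matrix (Fin 4) (Fin 4) ℂ) :=
  !![!![(q : ℂ), 0, 0, 0;
        0, 1, 0, 0;
        0, 0, 1, 0;
        (q : ℂ) * mu q ^ 2, 0, 0, (q : ℂ)⁻¹],
     !![0, 0, 0, 0;
        0, 0, 0, 0;
        mu q, 0, 0, 0;
        0, (q : ℂ) * mu q, 0, 0];
     !![0, 0, 0, 0;
        mu q, 0, 0, 0;
        0, 0, 0, 0;
        0, 0, (q : ℂ) * mu q, 0],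
     !![(q : ℂ)⁻¹, 0, 0, 0;
        0, 1, 0, 0;
        0, 0, 1, 0;
        0, 0, 0, (q : ℂ)]]

/-- The matrix of the action of the antipode `S t^i_k` on `Λ¹`, where
`S a = d`, `S b = -q b`, `S c = -q⁻¹ c`, `S d = a`. -/
def actS (q : ℂˣ) : Matrix (Fin 2) (Fin 2) (Matrix (Fin 4) (Fin 4) ℂ) :=
  !![act q 1 1, -((q : ℂ) • act q 0 1);
     -((q : ℂ)⁻¹ • act q 1 0), act q 0 0]

/-- The index `i` of `e_i^j`. -/
def lo : Fin 4 → Fin 2 := ![0, 0, 1, 1]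

/-- The index `j` of `e_i^j`. -/
def up : Fin 4 → Fin 2 := ![0, 1, 0, 1]

/-- The crossed module braiding: `braid q (p, s) (x, w)` is the coefficient of `e_p ⊗ e_s` in
`Ψ(e_x ⊗ e_w) = e_x⁽¹⁾ ▷ e_w ⊗ e_x⁽²⁾`, for the left coaction
`Δ_L e_i^j = ∑_{k,l} (S t^k_i) t^j_l ⊗ e_k^l`. -/
def braid (q : ℂˣ) : Matrix (Fin 4 × Fin 4) (Fin 4 × Fin 4) ℂ :=
  fun ps xw =>
    (actS q (lo ps.2) (lo xw.1) * act q (up xw.1) (up ps.2)) ps.1 xw.2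

/-! ### Braided antisymmetrizers -/

/-- The tensor power `(Λ¹)^{⊗ n}`: the function `x` stands for
`∑ w, x w • e_{w 0} ⊗ ⋯ ⊗ e_{w (n-1)}`. -/
abbrev Tens (n : ℕ) : Type := (Fin n → Fin 4) → ℂ

/-- `id ⊗ f` on `Λ¹ ⊗ (Λ¹)^{⊗ n}`. -/
def idTensor {n : ℕ} (f : Tens n →ₗ[ℂ] Tens n) : Tens (n + 1) →ₗ[ℂ] Tens (n + 1) where
  toFun x := fun w => f (fun v => x (Fin.cons (w 0) v)) (Fin.tail w)
  map_add' x y := by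
    funext w
    exact congrFun (f.map_add (fun v => x (Fin.cons (w 0) v)) (fun v => y (Fin.cons (w 0) v))) _
  map_smul' c x := by
    funext w
    exact congrFun (f.map_smul c (fun v => x (Fin.cons (w 0) v))) _

/-- `Ψ₁₂`, the braiding on the first two tensor factors. -/
def psi12 (q : ℂˣ) (n : ℕ) : Tens (n + 2) →ₗ[ℂ] Tens (n + 2) where
  toFun x := fun w => ∑ p : Fin 4, ∑ s : Fin 4,
    braid q (w 0, w 1) (p, s) * x (Fin.cons p (Fin.cons s (Fin.tail (Fin.tail w))))
  map_add' x y := by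
    funext w
    simp [mul_add, Finset.sum_add_distrib]
  map_smul' c x := by
    funext w
    simp only [Pi.smul_apply, smul_eq_mul, RingHom.id_apply, Finset.mul_sum]
    exact Finset.sum_congr rfl fun p _ => Finset.sum_congr rfl fun s _ => by ring

/-- The braided integer `[n, -Ψ] = id - Ψ₁₂ + Ψ₁₂Ψ₂₃ - ⋯ + (-1)^(n-1) Ψ₁₂ ⋯ Ψ_{n-1,n}`,
through `[n + 1, -Ψ] = id - Ψ₁₂ (id ⊗ [n, -Ψ])`. -/
def braidedInt (q : ℂˣ) : (n : ℕ) → Tens n →ₗ[ℂ] Tens n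
  | 0 => 0
  | 1 => LinearMap.id
  | n + 2 => LinearMap.id - psi12 q n ∘ₗ idTensor (braidedInt q (n + 1))

/-- The braided factorial (antisymmetrizer) `A_n = [n, -Ψ]! = (id ⊗ A_{n-1}) [n, -Ψ]`. -/
def antisym (q : ℂˣ) : (n : ℕ) → Tens n →ₗ[ℂ] Tens n
  | 0 => LinearMap.id
  | n + 1 => idTensor (antisym q n) ∘ₗ braidedInt q (n + 1)

/-! ### The exterior algebra `Ω` of the reduced quantum group -/

/-- Generators: `t i k` is the matrix entry `t^i_k` of the quantum group, `e p` a basis 1-form. -/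
inductive Gen : Type
  | t (i k : Fin 2)
  | e (p : Fin 4)

open FreeAlgebra in
/-- The defining relations of `Ω`: those of the reduced quantum group at `q^r = 1`, the bimodule
relations `h · v = (h₁ ▷ v) h₂`, and the relations `ker A_n` of the invariant exterior algebra `Λ`,
in every degree `n`. -/
inductive Rel (q : ℂˣ) (r : ℕ) : FreeAlgebra ℂ Gen → FreeAlgebra ℂ Gen → Prop
  | ba : Rel q r (ι ℂ (.t 0 1) * ι ℂ (.t 0 0)) ((q : ℂ) • (ι ℂ (.t 0 0) * ι ℂ (.t 0 1)))
  | ca : Rel q r (ι ℂ (.t 1 0) * ι ℂ (.t 0 0)) ((q : ℂ) • (ι ℂ (.t 0 0) * ι ℂ (.t 1 0)))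
  | db : Rel q r (ι ℂ (.t 1 1) * ι ℂ (.t 0 1)) ((q : ℂ) • (ι ℂ (.t 0 1) * ι ℂ (.t 1 1)))
  | dc : Rel q r (ι ℂ (.t 1 1) * ι ℂ (.t 1 0)) ((q : ℂ) • (ι ℂ (.t 1 0) * ι ℂ (.t 1 1)))
  | cb : Rel q r (ι ℂ (.t 1 0) * ι ℂ (.t 0 1)) (ι ℂ (.t 0 1) * ι ℂ (.t 1 0))
  | da : Rel q r (ι ℂ (.t 1 1) * ι ℂ (.t 0 0) - ι ℂ (.t 0 0) * ι ℂ (.t 1 1))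
      (((q : ℂ) * mu q) • (ι ℂ (.t 0 1) * ι ℂ (.t 1 0)))
  | det : Rel q r
      (ι ℂ (.t 0 0) * ι ℂ (.t 1 1) - (q : ℂ)⁻¹ • (ι ℂ (.t 0 1) * ι ℂ (.t 1 0))) 1
  | pow_a : Rel q r (ι ℂ (.t 0 0) ^ r) 1
  | pow_b : Rel q r (ι ℂ (.t 0 1) ^ r) 0
  | pow_c : Rel q r (ι ℂ (.t 1 0) ^ r) 0
  | pow_d : Rel q r (ι ℂ (.t 1 1) ^ r) 1
  | cross (i k : Fin 2) (p : Fin 4) : Rel q r (ι ℂ (.t i k) * ι ℂ (.e p))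
      (∑ l : Fin 2, ∑ s : Fin 4, act q i l s p • (ι ℂ (.e s) * ι ℂ (.t l k)))
  | ext (n : ℕ) (x : Tens n) (hx : antisym q n x = 0) : Rel q r
      (∑ w : Fin n → Fin 4, x w • (List.ofFn fun m => ι ℂ (Gen.e (w m))).prod) 0

/-- The exterior algebra `Ω` of the reduced quantum group `A`. It is the cross product of
`Λ = T Λ¹ / ⨁ ker A_n` and `A`, so that `Ω = Λ ⊗ A` as a right `A`-module. -/
def Omega (q : ℂˣ) (r : ℕ) : Type := RingQuot (Rel q r)

instance (q : ℂˣ) (r : ℕ) : Ring (Omega q r) := inferInstanceAs (Ring (RingQuot (Rel q r)))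

instance (q : ℂˣ) (r : ℕ) : Algebra ℂ (Omega q r) :=
  inferInstanceAs (Algebra ℂ (RingQuot (Rel q r)))

/-- The quotient map from the free algebra onto `Ω`. -/
def mk (q : ℂˣ) (r : ℕ) : FreeAlgebra ℂ Gen →ₐ[ℂ] Omega q r :=
  RingQuot.mkAlgHom ℂ (Rel q r)

lemma mk_rel (q : ℂˣ) (r : ℕ) {x y : FreeAlgebra ℂ Gen} (h : Rel q r x y) :
    mk q r x = mk q r y :=
  RingQuot.mkAlgHom_rel ℂ h

/-- The matrix generators `t^i_k` in `Ω`. -/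
def t (q : ℂˣ) (r : ℕ) (i k : Fin 2) : Omega q r :=
  mk q r (FreeAlgebra.ι ℂ (Gen.t i k))

/-- The basis 1-forms `e_a, e_b, e_c, e_d` in `Ω`. -/
def e (q : ℂˣ) (r : ℕ) (p : Fin 4) : Omega q r :=
  mk q r (FreeAlgebra.ι ℂ (Gen.e p))

/-- The reduced quantum group `A = Ω⁰` inside `Ω`. -/
def functions (q : ℂˣ) (r : ℕ) : Subalgebra ℂ (Omega q r) :=
  Algebra.adjoin ℂ (Set.range fun ik : Fin 2 × Fin 2 => t q r ik.1 ik.2)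

/-- The span `Λ¹` of the basis 1-forms. -/
def invForms (q : ℂˣ) (r : ℕ) : Submodule ℂ (Omega q r) :=
  Submodule.span ℂ (Set.range (e q r))

/-- The `n`-forms `Ωⁿ = Λⁿ · A`. -/
def forms (q : ℂˣ) (r n : ℕ) : Submodule ℂ (Omega q r) :=
  invForms q r ^ n * Subalgebra.toSubmodule (functions q r)

/-- The biinvariant 1-form `θ = e_a + e_d`. -/
def theta (q : ℂˣ) (r : ℕ) : Omega q r := e q r 0 + e q r 3

/-- The exterior derivative `d = -[θ, }` on forms of degree `n`: the commutator `ω θ - θ ω` for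
even `n` and minus the anticommutator, `-(ω θ + θ ω)`, for odd `n`. -/
def d (q : ℂˣ) (r n : ℕ) : Omega q r →ₗ[ℂ] Omega q r :=
  (-1 : ℂ) ^ n • LinearMap.mulRight ℂ (theta q r) - LinearMap.mulLeft ℂ (theta q r)

/-- Closed `n`-forms. -/
def closed (q : ℂˣ) (r n : ℕ) : Submodule ℂ (Omega q r) :=
  forms q r n ⊓ LinearMap.ker (d q r n)

/-- Exact `n`-forms. -/
def exact (q : ℂˣ) (r : ℕ) : ℕ → Submodule ℂ (Omega q r)
  | 0 => ⊥
  | n + 1 => (forms q r n).map (d q r n)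

/-- The noncommutative de Rham cohomology `Hⁿ`, closed forms modulo exact forms
(see `exact_le_closed` below). -/
abbrev H (q : ℂˣ) (r n : ℕ) : Type :=
  closed q r n ⧸ (exact q r n).submoduleOf (closed q r n)

/-! ### Multiplication by `θ` on cohomology -/

lemma antisym_theta (q : ℂˣ) :
    antisym q 2 (fun w => if (w 0 = 0 ∨ w 0 = 3) ∧ (w 1 = 0 ∨ w 1 = 3) then 1 else 0) = 0 := by
  have hq : (q : ℂ) ≠ 0 := q.ne_zero
  funext w
  obtain ⟨i, hi⟩ : ∃ i, w 0 = i := ⟨_, rfl⟩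
  obtain ⟨j, hj⟩ : ∃ j, w 1 = j := ⟨_, rfl⟩
  fin_cases i <;> fin_cases j <;>
    simp [antisym, braidedInt, idTensor, psi12, braid, hi, hj, Fin.sum_univ_four, act, actS, lo,
      up, Matrix.mul_apply, mu] <;> field_simp <;> ring

lemma theta_mul_theta (q : ℂˣ) (r : ℕ) : theta q r * theta q r = 0 := by
  have h := mk_rel q r (Rel.ext 2 _ (antisym_theta q))
  rw [map_sum, map_zero, ← (finTwoArrowEquiv (Fin 4)).symm.sum_comp, Fintype.sum_prod_type] at h
  simp only [Fin.sum_univ_four] at h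
  simp [finTwoArrowEquiv] at h
  rw [theta, ← h]
  simp only [e]
  noncomm_ring

lemma theta_mul_mem (q : ℂˣ) (r n : ℕ) {x : Omega q r} (hx : x ∈ forms q r n) :
    theta q r * x ∈ forms q r (n + 1) := by
  have h : theta q r ∈ invForms q r :=
    add_mem (Submodule.subset_span ⟨0, rfl⟩) (Submodule.subset_span ⟨3, rfl⟩)
  rw [forms, pow_succ', mul_assoc]
  exact Submodule.mul_mem_mul h hx

lemma functions_mul_invForms (q : ℂˣ) (r : ℕ) :
    Subalgebra.toSubmodule (functions q r) * invForms q r ≤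
      invForms q r * Subalgebra.toSubmodule (functions q r) := by
  rw [Submodule.mul_le]
  intro h hh
  have hh' : h ∈ Algebra.adjoin ℂ (Set.range fun ik : Fin 2 × Fin 2 => t q r ik.1 ik.2) := hh
  induction hh' using Algebra.adjoin_induction with
  | mem x hx =>
    obtain ⟨⟨i, k⟩, rfl⟩ := hx
    intro v hv
    induction hv using Submodule.span_induction with
    | mem v hv =>
      obtain ⟨p, rfl⟩ := hv
      have hc := mk_rel q r (Rel.cross (r := r) (q := q) i k p)
      simp only [map_sum, map_mul, map_smul] at hc
      change t q r i k * e q r p = _ at hc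
      change t q r i k * e q r p ∈ _
      rw [hc]
      exact Submodule.sum_mem _ fun l _ => Submodule.sum_mem _ fun s _ =>
        Submodule.smul_mem _ _ (Submodule.mul_mem_mul (Submodule.subset_span ⟨s, rfl⟩)
          (Algebra.subset_adjoin ⟨(l, k), rfl⟩))
    | zero => rw [mul_zero]; exact zero_mem _
    | add v w _ _ ihv ihw => rw [mul_add]; exact add_mem ihv ihw
    | smul c v _ ih => rw [mul_smul_comm]; exact Submodule.smul_mem _ _ ih
  | algebraMap c =>
    intro v hv
    rw [Algebra.commutes]
    exact Submodule.mul_mem_mul hv ((functions q r).algebraMap_mem c)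
  | add x y hx hy ihx ihy =>
    intro v hv
    rw [add_mul]
    exact add_mem (ihx hx v hv) (ihy hy v hv)
  | mul x y hx hy ihx ihy =>
    intro v hv
    rw [mul_assoc]
    refine Submodule.mul_induction_on (ihy hy v hv) (fun u hu g hg => ?_) (fun u w hu hw => ?_)
    · rw [← mul_assoc]
      refine Submodule.mul_induction_on (ihx hx u hu) (fun u' hu' g' hg' => ?_)
        (fun u' w' hu' hw' => ?_)
      · rw [mul_assoc]
        exact Submodule.mul_mem_mul hu' ((functions q r).mul_mem hg' hg)
      · rw [add_mul]
        exact add_mem hu' hw'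
    · rw [mul_add]
      exact add_mem hu hw

lemma mul_theta_mem (q : ℂˣ) (r n : ℕ) {x : Omega q r} (hx : x ∈ forms q r n) :
    x * theta q r ∈ forms q r (n + 1) := by
  have h : theta q r ∈ invForms q r :=
    add_mem (Submodule.subset_span ⟨0, rfl⟩) (Submodule.subset_span ⟨3, rfl⟩)
  have h2 : forms q r n * invForms q r ≤ forms q r (n + 1) := by
    rw [forms, forms, pow_succ, mul_assoc, mul_assoc]
    exact mul_le_mul' le_rfl (functions_mul_invForms q r)
  exact h2 (Submodule.mul_mem_mul hx h)

lemma d_mem (q : ℂˣ) (r n : ℕ) {x : Omega q r} (hx : x ∈ forms q r n) :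
    d q r n x ∈ forms q r (n + 1) :=
  sub_mem (Submodule.smul_mem _ _ (mul_theta_mem q r n hx)) (theta_mul_mem q r n hx)

lemma d_apply (q : ℂˣ) (r n : ℕ) (x : Omega q r) :
    d q r n x = (-1 : ℂ) ^ n • (x * theta q r) - theta q r * x := rfl

lemma d_theta_mul (q : ℂˣ) (r n : ℕ) (x : Omega q r) :
    d q r (n + 1) (theta q r * x) = -(theta q r * d q r n x) := by
  have h : theta q r * (theta q r * x) = 0 := by rw [← mul_assoc, theta_mul_theta, zero_mul]
  simp only [d_apply, mul_sub, mul_smul_comm, h, pow_succ, mul_assoc, sub_zero]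
  simp [neg_smul]

lemma d_d (q : ℂˣ) (r n : ℕ) (x : Omega q r) : d q r (n + 1) (d q r n x) = 0 := by
  have h : x * theta q r * theta q r = 0 := by rw [mul_assoc, theta_mul_theta, mul_zero]
  have h' : d q r (n + 1) (x * theta q r) = -(theta q r * (x * theta q r)) := by
    rw [d_apply, h, smul_zero, zero_sub]
  have h2 : theta q r * (theta q r * x) = 0 := by rw [← mul_assoc, theta_mul_theta, zero_mul]
  rw [d_apply q r n x, map_sub, map_smul, h', d_theta_mul, d_apply, mul_sub, h2, mul_smul_comm]
  simp

lemma exact_le_closed (q : ℂˣ) (r n : ℕ) : exact q r n ≤ closed q r n := by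
  cases n with
  | zero => exact bot_le
  | succ n =>
    rintro _ ⟨x, hx, rfl⟩
    exact ⟨d_mem q r n hx, d_d q r n x⟩

/-- `ω ↦ θ ∧ ω` on closed forms. -/
def thetaClosed (q : ℂˣ) (r n : ℕ) : closed q r n →ₗ[ℂ] closed q r (n + 1) :=
  (LinearMap.mulLeft ℂ (theta q r)).restrict fun x hx =>
    ⟨theta_mul_mem q r n hx.1, by
      have h : d q r n x = 0 := hx.2
      change d q r (n + 1) (theta q r * x) = 0
      rw [d_theta_mul, h, mul_zero, neg_zero]⟩

lemma thetaClosed_exact (q : ℂˣ) (r n : ℕ) :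
    (exact q r n).submoduleOf (closed q r n) ≤
      ((exact q r (n + 1)).submoduleOf (closed q r (n + 1))).comap (thetaClosed q r n) := by
  intro x hx
  change theta q r * (x : Omega q r) ∈ exact q r (n + 1)
  have hx' : (x : Omega q r) ∈ exact q r n := hx
  cases n with
  | zero =>
    have h0 : (x : Omega q r) = 0 := hx'
    rw [h0, mul_zero]
    exact zero_mem _
  | succ n =>
    obtain ⟨y, hy, hxy⟩ := hx'
    refine ⟨-(theta q r * y), neg_mem (theta_mul_mem q r n hy), ?_⟩
    rw [map_neg, d_theta_mul, neg_neg, hxy]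

/-- The map `θ ∧ : Hⁿ → Hⁿ⁺¹`, `[ω] ↦ [θ ∧ ω]`. -/
def thetaH (q : ℂˣ) (r n : ℕ) : H q r n →ₗ[ℂ] H q r (n + 1) :=
  Submodule.mapQ _ _ (thetaClosed q r n) (thetaClosed_exact q r n)

end

end QSL2

/-!
The multiplication `θ ∧` is exact on the cohomology because it has a contracting homotopy that
anticommutes with `d`.

The antisymmetrizers factor as `A_n = (id ⊗ A_{n-1}) [n, -Ψ]`, so the braided integer `[n, -Ψ]`
descends to `Λ` and defines contractions `i_p : Ωⁿ⁺¹ → Ωⁿ` with the vectors dual to the `e_p`. As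
`θ` is coinvariant, `i_p θ + θ i_p = θ_p`, with `θ_p` the coefficient of `e_p` in `θ`. Moving `i_p`
past multiplication by `θ` from the right gives a Cartan formula, `i_p d + d i_p = T_p - θ_p`
(`contr_d`), in which `T_p ω = ⟨e_p, ω⁽¹⁾ ▷ θ⟩ ω⁽²⁾` comes from the left coaction of the quantum
group on `Ω`. The operators `T_p` commute with multiplication by `θ` on either side, hence with `d`.

The operator `i_a` therefore satisfies `i_a θ + θ i_a = 1`, but `i_a d + d i_a = T_a - 1` need not
vanish. The operators obey the determinant relation `T_a T_d - q² T_b T_c = 1` of the `L`-matrix of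
`u_q(sl₂)` (`convRel`), and `T_a ^ r = 1`. So `T_a² - 1 = T_a (T_a - T_d) + q² T_b T_c`, and since
`r` is odd, `T_a - 1 = T_a ^ (r + 1) - 1` is a multiple of `T_a² - 1`; this writes
`T_a - 1 = U (T_a - T_d) + V T_c` with `U`, `V` in the algebra of the `T_p`. The coefficients of
`e_a` and `e_d` in `θ` agree and that of `e_c` is zero, so `J = i_a - U (i_a - i_d) - V i_c` has
`J θ + θ J = 1` and `J d + d J = 0` (`exists_homotopy`). Exactness follows, and surjectivity onto
the cohomology in degree 4 because the quadratic relations of `Λ` leave no 5-forms (`forms_five`).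

What needs care is that the coaction and the contractions are well defined on `Ω`, which is given by
generators and relations. Both are obtained as algebra maps from `Ω` to matrices over `Ω`; the
relations in `ker A_n` are respected because `Ψ` satisfies the braid relation (`braid_yangBaxter`),
itself a consequence of the crossed module condition for `Λ¹`.
-/

namespace QSL2

noncomputable section

open scoped Kronecker

/-! ### The crossed module condition and the braid relation -/

/-- The matrix through which `(S tʸ_x) t^x_y`, the coefficient of `e_y` in the left coaction of
`e_x`, acts on `Λ¹`; the blocks of the braiding. -/
def coactMat (q : ℂˣ) (y x : Fin 4) : Matrix (Fin 4) (Fin 4) ℂ :=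
  actS q (lo y) (lo x) * act q (up x) (up y)

lemma braid_apply (q : ℂˣ) (p s x w : Fin 4) :
    braid q (p, s) (x, w) = coactMat q s x p w := rfl

lemma sum_actS_mul_act (q : ℂˣ) (i k : Fin 2) :
    ∑ j, actS q i j * act q j k = if i = k then 1 else 0 := by
  have hq : (q : ℂ) ≠ 0 := q.ne_zero
  have h0 : (0 : Matrix (Fin 4) (Fin 4) ℂ) =
      !![0, 0, 0, 0; 0, 0, 0, 0; 0, 0, 0, 0; 0, 0, 0, 0] := by
    ext a b; fin_cases a <;> fin_cases b <;> rfl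
  have h1 : (1 : Matrix (Fin 4) (Fin 4) ℂ) =
      !![1, 0, 0, 0; 0, 1, 0, 0; 0, 0, 1, 0; 0, 0, 0, 1] := by
    ext a b; fin_cases a <;> fin_cases b <;> rfl
  rw [h0, h1]
  fin_cases i <;> fin_cases k <;> simp [Fin.sum_univ_two, act, actS]
  all_goals (simp only [mu]; field_simp; try ring1)

lemma sum_act_mul_actS (q : ℂˣ) (i k : Fin 2) :
    ∑ j, act q i j * actS q j k = if i = k then 1 else 0 := by
  have hq : (q : ℂ) ≠ 0 := q.ne_zero
  have h0 : (0 : Matrix (Fin 4) (Fin 4) ℂ) =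
      !![0, 0, 0, 0; 0, 0, 0, 0; 0, 0, 0, 0; 0, 0, 0, 0] := by
    ext a b; fin_cases a <;> fin_cases b <;> rfl
  have h1 : (1 : Matrix (Fin 4) (Fin 4) ℂ) =
      !![1, 0, 0, 0; 0, 1, 0, 0; 0, 0, 1, 0; 0, 0, 0, 1] := by
    ext a b; fin_cases a <;> fin_cases b <;> rfl
  rw [h0, h1]
  fin_cases i <;> fin_cases k <;> simp [Fin.sum_univ_two, act, actS]
  all_goals (simp only [mu]; field_simp; try ring1)

/-- The action of `t^i_m` on `Λ¹ ⊗ Λ¹` through the coproduct. -/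
def actTwo (q : ℂˣ) (i m : Fin 2) : Matrix (Fin 4 × Fin 4) (Fin 4 × Fin 4) ℂ :=
  ∑ l, act q i l ⊗ₖ act q l m

/-- The action of `S t^i_m` on `Λ¹ ⊗ Λ¹`; the antipode reverses the coproduct. -/
def actSTwo (q : ℂˣ) (i m : Fin 2) : Matrix (Fin 4 × Fin 4) (Fin 4 × Fin 4) ℂ :=
  ∑ l, actS q l m ⊗ₖ actS q i l

lemma kronecker_sum {ι : Type*} [Fintype ι] {n : Type*} (A : Matrix n n ℂ)
    (B : ι → Matrix n n ℂ) : ∑ j, A ⊗ₖ B j = A ⊗ₖ (∑ j, B j) := by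
  ext ⟨a, b⟩ ⟨c, d⟩
  simp [Matrix.sum_apply, Finset.mul_sum]

lemma sum_kronecker {ι : Type*} [Fintype ι] {n : Type*} (A : ι → Matrix n n ℂ)
    (B : Matrix n n ℂ) : ∑ j, A j ⊗ₖ B = (∑ j, A j) ⊗ₖ B := by
  ext ⟨a, b⟩ ⟨c, d⟩
  simp [Matrix.sum_apply, Finset.sum_mul]

lemma sum_actTwo_mul_actSTwo (q : ℂˣ) (i m : Fin 2) :
    ∑ j, actTwo q i j * actSTwo q j m = if i = m then 1 else 0 := by
  simp only [actTwo, actSTwo, Finset.sum_mul_sum, ← Matrix.mul_kronecker_mul]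
  rw [Finset.sum_comm]
  have h (l : Fin 2) : ∑ j, ∑ l', (act q i l * actS q l' m) ⊗ₖ (act q l j * actS q j l') =
      (act q i l * actS q l m) ⊗ₖ 1 := by
    rw [Finset.sum_comm]
    simp only [kronecker_sum, sum_act_mul_actS]
    rw [Finset.sum_eq_single l] <;> simp +contextual [eq_comm]
  simp only [h, sum_kronecker, sum_act_mul_actS]
  split_ifs <;> simp

lemma sum_actSTwo_mul_actTwo (q : ℂˣ) (i m : Fin 2) :
    ∑ j, actSTwo q i j * actTwo q j m = if i = m then 1 else 0 := by
  simp only [actTwo, actSTwo, Finset.sum_mul_sum, ← Matrix.mul_kronecker_mul]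
  rw [Finset.sum_comm]
  have h (l : Fin 2) : ∑ j, ∑ l', (actS q l j * act q j l') ⊗ₖ (actS q i l * act q l' m) =
      1 ⊗ₖ (actS q i l * act q l m) := by
    rw [Finset.sum_comm]
    simp only [sum_kronecker, sum_actS_mul_act]
    rw [Finset.sum_eq_single l] <;> simp +contextual [eq_comm]
  simp only [h, kronecker_sum, sum_actS_mul_act]
  split_ifs <;> simp

/-- The entries of `act`, in a form that evaluates one entry at a time. -/
def actCoeff (q : ℂˣ) : Fin 2 → Fin 2 → Fin 4 → Fin 4 → ℂ
  | 0, 0 => ![![q, 0, 0, 0], ![0, 1, 0, 0], ![0, 0, 1, 0], ![q * mu q ^ 2, 0, 0, (q : ℂ)⁻¹]]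
  | 0, 1 => ![![0, 0, 0, 0], ![0, 0, 0, 0], ![mu q, 0, 0, 0], ![0, q * mu q, 0, 0]]
  | 1, 0 => ![![0, 0, 0, 0], ![mu q, 0, 0, 0], ![0, 0, 0, 0], ![0, 0, q * mu q, 0]]
  | 1, 1 => ![![(q : ℂ)⁻¹, 0, 0, 0], ![0, 1, 0, 0], ![0, 0, 1, 0], ![0, 0, 0, q]]

lemma act_apply (q : ℂˣ) (i k : Fin 2) (p s : Fin 4) : act q i k p s = actCoeff q i k p s := by
  fin_cases i <;> fin_cases k <;> rfl

set_option maxHeartbeats 4000000 in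
/-- The compatibility of action and coaction in the crossed module `Λ¹`, for the generators `t^i_m`.
-/
lemma sum_act_smul_act_mul_coactMat (q : ℂˣ) (p y : Fin 4) (i m : Fin 2) :
    ∑ l, ∑ s, act q l m y s • (act q i l * coactMat q s p) =
      ∑ l, ∑ s, act q i l s p • (coactMat q y s * act q l m) := by
  have hq : (q : ℂ) ≠ 0 := q.ne_zero
  simp only [Fin.sum_univ_four, Fin.sum_univ_two]
  -- Most scalar coefficients vanish; evaluating them first leaves few matrix products.
  fin_cases i <;> fin_cases m <;> fin_cases p <;> fin_cases y <;>
    simp only [Fin.zero_eta, Fin.mk_one, Fin.reduceFinMk, act_apply] <;>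
    simp only [actCoeff, Matrix.cons_val, zero_smul, zero_add, add_zero, coactMat, lo, up] <;>
    simp [act, actS]
  all_goals (repeat' apply And.intro)
  all_goals first
    | (ext j; fin_cases j <;> rfl)
    | (simp only [mu]; field_simp; done)
    | (simp only [mu]; field_simp; ring)
    | field_simp

/-- The crossed module condition says that the braiding is a module map. -/
lemma actTwo_mul_braid (q : ℂˣ) (i m : Fin 2) :
    actTwo q i m * braid q = braid q * actTwo q i m := by
  ext ⟨a, y⟩ ⟨p, b⟩
  have h := congrFun (congrFun (sum_act_smul_act_mul_coactMat q p y i m) a) b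
  simp only [Matrix.sum_apply, Matrix.smul_apply, Matrix.mul_apply, smul_eq_mul] at h
  simp only [actTwo, Matrix.mul_apply, Matrix.sum_apply, Fintype.sum_prod_type,
    Matrix.kroneckerMap_apply, braid_apply]
  convert h using 1
  · simp only [Finset.sum_mul, Finset.mul_sum]
    rw [Finset.sum_congr rfl fun _ _ => Finset.sum_comm, Finset.sum_comm]
    refine Finset.sum_congr rfl fun l _ => ?_
    rw [Finset.sum_comm]
    exact Finset.sum_congr rfl fun s _ => Finset.sum_congr rfl fun c _ => by ring
  · simp only [Finset.mul_sum]
    rw [Finset.sum_congr rfl fun _ _ => Finset.sum_comm, Finset.sum_comm]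
    exact Finset.sum_congr rfl fun l _ => Finset.sum_congr rfl fun s _ =>
      Finset.sum_congr rfl fun c _ => by ring

/-- The matrix `actSTwo` is inverse to `actTwo`, so its entries commute with the braiding too. -/
lemma actSTwo_mul_braid (q : ℂˣ) (i m : Fin 2) :
    actSTwo q i m * braid q = braid q * actSTwo q i m := by
  calc actSTwo q i m * braid q
      = ∑ j, actSTwo q i j * (braid q * ∑ k, actTwo q j k * actSTwo q k m) := by
        simp only [sum_actTwo_mul_actSTwo]
        rw [Finset.sum_eq_single m] <;> simp +contextual
    _ = ∑ k, ((∑ j, actSTwo q i j * actTwo q j k) * braid q) * actSTwo q k m := by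
        simp only [Finset.mul_sum, Finset.sum_mul]
        rw [Finset.sum_comm]
        refine Finset.sum_congr rfl fun k _ => Finset.sum_congr rfl fun j _ => ?_
        rw [← mul_assoc (braid q), ← actTwo_mul_braid]
        simp only [mul_assoc]
    _ = braid q * actSTwo q i m := by
        simp only [sum_actSTwo_mul_actTwo]
        rw [Finset.sum_eq_single i] <;> simp +contextual [eq_comm]

/-- The crossed module condition for the antipodes `S t^i_m`. -/
lemma sum_actS_smul_actS_mul_coactMat (q : ℂˣ) (p y : Fin 4) (i m : Fin 2) :
    ∑ l, ∑ s, actS q i l y s • (actS q l m * coactMat q s p) =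
      ∑ l, ∑ s, actS q l m s p • (coactMat q y s * actS q i l) := by
  ext a b
  have h := congrFun (congrFun (actSTwo_mul_braid q i m) (a, y)) (p, b)
  simp only [actSTwo, Matrix.mul_apply, Matrix.sum_apply, Fintype.sum_prod_type,
    Matrix.kroneckerMap_apply, braid_apply] at h
  simp only [Matrix.sum_apply, Matrix.smul_apply, Matrix.mul_apply, smul_eq_mul]
  convert h using 1
  · simp only [Finset.sum_mul, Finset.mul_sum]
    symm
    rw [Finset.sum_congr rfl fun _ _ => Finset.sum_comm, Finset.sum_comm]
    refine Finset.sum_congr rfl fun l _ => ?_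
    rw [Finset.sum_comm]
    exact Finset.sum_congr rfl fun s _ => Finset.sum_congr rfl fun c _ => by ring
  · simp only [Finset.mul_sum]
    symm
    rw [Finset.sum_congr rfl fun _ _ => Finset.sum_comm, Finset.sum_comm]
    exact Finset.sum_congr rfl fun l _ => Finset.sum_congr rfl fun s _ =>
      Finset.sum_congr rfl fun c _ => by ring

/-- A sum over the basis of `Λ¹` is a double sum over the indices of `e_i^j`. -/
lemma sum_lo_up {M : Type*} [AddCommMonoid M] (f : Fin 2 → Fin 2 → M) :
    ∑ u : Fin 4, f (lo u) (up u) = ∑ l, ∑ m, f l m := by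
  simp [Fin.sum_univ_four, lo, up, add_assoc]

/-- The braid relation for `Ψ`, in terms of its blocks. It follows by applying the crossed module
condition once for each of the two factors of `coactMat`. -/
lemma braid_yangBaxter (q : ℂˣ) (y z x w : Fin 4) :
    ∑ u, ∑ v, braid q (y, z) (u, v) • (coactMat q u x * coactMat q v w) =
      ∑ u, ∑ v, braid q (u, v) (x, w) • (coactMat q y u * coactMat q z v) := by
  have e1 : ∑ u, ∑ v, braid q (y, z) (u, v) • (coactMat q u x * coactMat q v w) =
      ∑ l, ∑ c, actS q (lo z) l y c • (actS q l (lo x) *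
        ∑ m, ∑ v, act q m (up z) c v • (act q (up x) m * coactMat q v w)) := by
    refine (sum_lo_up fun l m => ∑ v, (actS q (lo z) l * act q m (up z)) y v •
      ((actS q l (lo x) * act q (up x) m) * coactMat q v w)).trans
        (Finset.sum_congr rfl fun l _ => ?_)
    simp only [Matrix.mul_apply, Finset.sum_smul, Finset.mul_sum, Finset.smul_sum, mul_smul,
      mul_smul_comm, mul_assoc]
    rw [Finset.sum_congr rfl fun _ _ => Finset.sum_comm, Finset.sum_comm]
  have e2 : ∑ u, ∑ v, braid q (u, v) (x, w) • (coactMat q y u * coactMat q z v) =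
      ∑ m, ∑ s, act q (up x) m s w • ((∑ l, ∑ u, actS q l (lo x) u s •
        (coactMat q y u * actS q (lo z) l)) * act q m (up z)) := by
    have (u : Fin 4) : ∑ v, braid q (u, v) (x, w) • (coactMat q y u * coactMat q z v) =
        ∑ l, ∑ m, (actS q l (lo x) * act q (up x) m) u w •
          (coactMat q y u * (actS q (lo z) l * act q m (up z))) :=
      sum_lo_up fun l m => (actS q l (lo x) * act q (up x) m) u w •
          (coactMat q y u * (actS q (lo z) l * act q m (up z)))
    simp only [this, Matrix.mul_apply, Finset.sum_smul, Finset.sum_mul, Finset.smul_sum, mul_smul,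
      smul_mul_assoc, mul_assoc]
    rw [Finset.sum_comm, Finset.sum_congr rfl fun _ _ => Finset.sum_comm, Finset.sum_comm]
    refine Finset.sum_congr rfl fun m _ => ?_
    conv_rhs => rw [Finset.sum_comm]
    refine Finset.sum_congr rfl fun l _ => ?_
    rw [Finset.sum_comm]
    exact Finset.sum_congr rfl fun u _ => Finset.sum_congr rfl fun s _ => smul_comm _ _ _
  rw [e1, e2]
  simp only [sum_act_smul_act_mul_coactMat, ← sum_actS_smul_actS_mul_coactMat]
  simp only [Finset.mul_sum, Finset.sum_mul, Finset.smul_sum, mul_smul_comm, smul_mul_assoc,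
    mul_assoc]
  conv_rhs => rw [Finset.sum_congr rfl fun _ _ => Finset.sum_comm, Finset.sum_comm]
  refine Finset.sum_congr rfl fun l _ => ?_
  rw [Finset.sum_comm]
  refine Finset.sum_congr rfl fun m _ => ?_
  rw [Finset.sum_comm]
  exact Finset.sum_congr rfl fun u _ => Finset.sum_congr rfl fun s _ => smul_comm _ _ _

/-! ### The coaction on tensor powers -/

/-- The coefficient of `e_p` in the first tensor factor. -/
def slice {n : ℕ} (p : Fin 4) : Tens (n + 1) →ₗ[ℂ] Tens n where
  toFun x := fun v => x (Fin.cons p v)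
  map_add' _ _ := rfl
  map_smul' _ _ := rfl

lemma tens_ext {n : ℕ} {x y : Tens (n + 1)} (h : ∀ p, slice p x = slice p y) : x = y := by
  funext w
  have := congrFun (h (w 0)) (Fin.tail w)
  simpa [slice, Fin.cons_self_tail] using this

lemma slice_idTensor {n : ℕ} (f : Tens n →ₗ[ℂ] Tens n) (p : Fin 4) (x : Tens (n + 1)) :
    slice p (idTensor f x) = f (slice p x) := rfl

lemma slice_slice_psi12 (q : ℂˣ) (n : ℕ) (p s : Fin 4) (x : Tens (n + 2)) :
    slice s (slice p (psi12 q n x)) =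
      ∑ p', ∑ s', braid q (p, s) (p', s') • slice s' (slice p' x) := by
  funext w
  simp only [Finset.sum_apply, Pi.smul_apply, smul_eq_mul]
  rfl

/-- The coaction on `(Λ¹)^{⊗ n}` followed by the action on `Λ¹`: `coact q n p s x` is the `(p, s)`
matrix entry of `x⁽¹⁾ ▷`, times `x⁽²⁾`. As a map `(Λ¹)^{⊗ n} ⊗ Λ¹ → Λ¹ ⊗ (Λ¹)^{⊗ n}` it is the
iterated braiding. -/
def coact (q : ℂˣ) : (n : ℕ) → Fin 4 → Fin 4 → Tens n →ₗ[ℂ] Tens n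
  | 0, p, s => if p = s then LinearMap.id else 0
  | n + 1, p, s =>
    { toFun := fun x w =>
        ∑ z, ∑ u, coactMat q (w 0) z p u * coact q n u s (slice z x) (Fin.tail w)
      map_add' := fun x y => by
        funext w
        simp [mul_add, Finset.sum_add_distrib]
      map_smul' := fun c x => by
        funext w
        simp only [map_smul, Pi.smul_apply, smul_eq_mul, RingHom.id_apply, Finset.mul_sum]
        exact Finset.sum_congr rfl fun _ _ => Finset.sum_congr rfl fun _ _ => by ring }

lemma slice_coact (q : ℂˣ) (n : ℕ) (p s y : Fin 4) (x : Tens (n + 1)) :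
    slice y (coact q (n + 1) p s x) =
      ∑ z, ∑ u, coactMat q y z p u • coact q n u s (slice z x) := by
  funext w
  simp only [Finset.sum_apply, Pi.smul_apply, smul_eq_mul]
  rfl

lemma coact_idTensor (q : ℂˣ) {n : ℕ} {f : Tens n →ₗ[ℂ] Tens n}
    (hf : ∀ p s x, coact q n p s (f x) = f (coact q n p s x)) (p s : Fin 4) (x : Tens (n + 1)) :
    coact q (n + 1) p s (idTensor f x) = idTensor f (coact q (n + 1) p s x) := by
  refine tens_ext fun y => ?_
  simp only [slice_coact, slice_idTensor, hf, map_sum, map_smul]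

lemma slice_slice_coact (q : ℂˣ) (n : ℕ) (p s y z : Fin 4) (x : Tens (n + 2)) :
    slice z (slice y (coact q (n + 2) p s x)) =
      ∑ v, ∑ c, ∑ d, (coactMat q y c * coactMat q z d) p v •
        coact q n v s (slice d (slice c x)) := by
  simp only [slice_coact, map_sum, map_smul, Matrix.mul_apply, Finset.sum_smul, Finset.smul_sum,
    smul_smul]
  rw [Finset.sum_comm]
  conv_rhs => rw [Finset.sum_comm]
  rw [Finset.sum_comm]
  refine Finset.sum_congr rfl fun c _ => ?_
  conv_rhs => rw [Finset.sum_comm, Finset.sum_congr rfl fun _ _ => Finset.sum_comm]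
  conv_rhs => rw [Finset.sum_comm]

lemma sum_comm_three {M ι κ τ : Type*} [AddCommMonoid M] [Fintype ι] [Fintype κ] [Fintype τ]
    (f : ι → κ → τ → M) : ∑ a, ∑ b, ∑ c, f a b c = ∑ b, ∑ c, ∑ a, f a b c := by
  rw [Finset.sum_comm]
  exact Finset.sum_congr rfl fun b _ => Finset.sum_comm

lemma sum_comm_four {M ι κ τ υ : Type*} [AddCommMonoid M] [Fintype ι] [Fintype κ] [Fintype τ]
    [Fintype υ] (f : ι → κ → τ → υ → M) :
    ∑ a, ∑ b, ∑ c, ∑ d, f a b c d = ∑ c, ∑ d, ∑ a, ∑ b, f a b c d :=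
  (Finset.sum_congr rfl fun _ _ => sum_comm_three _).trans (sum_comm_three _)

/-- The braiding is a comodule map, by the braid relation. -/
lemma coact_psi12 (q : ℂˣ) (n : ℕ) (p s : Fin 4) (x : Tens (n + 2)) :
    coact q (n + 2) p s (psi12 q n x) = psi12 q n (coact q (n + 2) p s x) := by
  refine tens_ext fun y => tens_ext fun z => ?_
  simp only [slice_slice_coact, slice_slice_psi12, map_sum, map_smul, Finset.smul_sum, smul_smul]
  have h (v c d : Fin 4) := congrFun (congrFun (braid_yangBaxter q y z c d) p) v
  simp only [Matrix.sum_apply, Matrix.smul_apply, smul_eq_mul] at h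
  trans ∑ v, ∑ c, ∑ d, (∑ a, ∑ b, braid q (a, b) (c, d) *
    (coactMat q y a * coactMat q z b) p v) • coact q n v s (slice d (slice c x))
  · refine Finset.sum_congr rfl fun v _ => ?_
    rw [sum_comm_four]
    simp only [Finset.sum_smul]
    exact Finset.sum_congr rfl fun c _ => Finset.sum_congr rfl fun d _ => Finset.sum_congr rfl
      fun a _ => Finset.sum_congr rfl fun b _ => by rw [mul_comm]
  · simp only [← h, Finset.sum_smul]
    rw [Finset.sum_congr rfl fun v _ => sum_comm_four _, sum_comm_three]

lemma coact_braidedInt (q : ℂˣ) (n : ℕ) (p s : Fin 4) (x : Tens n) :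
    coact q n p s (braidedInt q n x) = braidedInt q n (coact q n p s x) := by
  induction n generalizing p s with
  | zero => simp [braidedInt]
  | succ n ih =>
    cases n with
    | zero => rfl
    | succ n =>
      simp only [braidedInt, LinearMap.sub_apply, LinearMap.comp_apply, LinearMap.id_apply, map_sub,
        coact_psi12, coact_idTensor q fun p s x => ih p s x]

/-- The antisymmetrizers are comodule maps, so `ker A_n` is a subcomodule. -/
lemma coact_antisym (q : ℂˣ) (n : ℕ) (p s : Fin 4) (x : Tens n) :
    coact q n p s (antisym q n x) = antisym q n (coact q n p s x) := by
  induction n generalizing p s with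
  | zero => rfl
  | succ n ih =>
    simp only [antisym, LinearMap.comp_apply, coact_idTensor q fun p s x => ih p s x,
      coact_braidedInt]

/-! ### Evaluation of tensors in an algebra -/

section wordEval

variable {B : Type*} [Ring B] [Algebra ℂ B]

/-- The evaluation of a tensor at elements `g p` of an algebra: `e_p ⊗ e_s ⊗ ⋯ ↦ g p * g s * ⋯`. -/
def wordEval (g : Fin 4 → B) : (n : ℕ) → Tens n →ₗ[ℂ] B
  | 0 => (LinearMap.proj Fin.elim0).smulRight 1
  | n + 1 => ∑ p, LinearMap.mulLeft ℂ (g p) ∘ₗ wordEval g n ∘ₗ slice p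

lemma wordEval_zero (g : Fin 4 → B) (x : Tens 0) : wordEval g 0 x = x Fin.elim0 • 1 := rfl

lemma wordEval_succ (g : Fin 4 → B) (n : ℕ) (x : Tens (n + 1)) :
    wordEval g (n + 1) x = ∑ p, g p * wordEval g n (slice p x) := by
  simp [wordEval]

lemma wordEval_eq_sum (g : Fin 4 → B) (n : ℕ) (x : Tens n) :
    wordEval g n x = ∑ w : Fin n → Fin 4, x w • (List.ofFn fun m => g (w m)).prod := by
  induction n with
  | zero =>
    rw [wordEval_zero, Fintype.sum_unique, List.ofFn_zero, List.prod_nil]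
    exact congrArg (fun w => x w • (1 : B)) (Subsingleton.elim _ _)
  | succ n ih =>
    rw [wordEval_succ, ← (Fin.consEquiv fun _ => Fin 4).sum_comp, Fintype.sum_prod_type]
    refine Finset.sum_congr rfl fun p _ => ?_
    rw [ih, Finset.mul_sum]
    refine Finset.sum_congr rfl fun w _ => ?_
    simp [Fin.consEquiv, slice, List.ofFn_succ]

/-- The element `c ⊗ b` of `M₄(ℂ) ⊗ B`, as a matrix over `B`. -/
def ten (c : Matrix (Fin 4) (Fin 4) ℂ) (b : B) : Matrix (Fin 4) (Fin 4) B :=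
  Matrix.of fun p s => c p s • b

lemma ten_apply (c : Matrix (Fin 4) (Fin 4) ℂ) (b : B) (p s : Fin 4) :
    ten c b p s = c p s • b := rfl

lemma ten_mul_ten (c c' : Matrix (Fin 4) (Fin 4) ℂ) (b b' : B) :
    ten c b * ten c' b' = ten (c * c') (b * b') := by
  ext p s
  simp only [ten_apply, Matrix.mul_apply, Finset.sum_smul, smul_mul_smul_comm]

/-- Evaluation at the coactions of the `e_z` is the coaction followed by evaluation. -/
lemma wordEval_ten (q : ℂˣ) (g : Fin 4 → B) (n : ℕ) (x : Tens n) (p s : Fin 4) :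
    wordEval (fun z => ∑ y, ten (coactMat q y z) (g y)) n x p s =
      wordEval g n (coact q n p s x) := by
  induction n generalizing p s with
  | zero =>
    rw [wordEval_zero, wordEval_zero, Matrix.smul_apply, Matrix.one_apply, coact]
    split_ifs <;> simp
  | succ n ih =>
    simp only [wordEval_succ, Matrix.sum_apply, Matrix.mul_apply, ten_apply, slice_coact, map_sum,
      map_smul, ih, Finset.sum_mul, Finset.mul_sum, smul_mul_assoc, mul_smul_comm]
    rw [Finset.sum_comm]

end wordEval

/-! ### Quantum matrices and their powers -/

section quantumMatrix

variable {B : Type*} [Ring B] [Algebra ℂ B]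

/-- The entries of `x` satisfy the relations of `ℂ_q[SL₂]`. -/
structure IsQuantumMatrix (q : ℂˣ) (x : Fin 2 → Fin 2 → B) : Prop where
  ba : x 0 1 * x 0 0 = (q : ℂ) • (x 0 0 * x 0 1)
  ca : x 1 0 * x 0 0 = (q : ℂ) • (x 0 0 * x 1 0)
  db : x 1 1 * x 0 1 = (q : ℂ) • (x 0 1 * x 1 1)
  dc : x 1 1 * x 1 0 = (q : ℂ) • (x 1 0 * x 1 1)
  cb : x 1 0 * x 0 1 = x 0 1 * x 1 0
  da : x 1 1 * x 0 0 - x 0 0 * x 1 1 = ((q : ℂ) * mu q) • (x 0 1 * x 1 0)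
  det : x 0 0 * x 1 1 - (q : ℂ)⁻¹ • (x 0 1 * x 1 0) = 1

/-- The product of two commuting quantum matrices is a quantum matrix: the coproduct is an algebra
map. -/
lemma IsQuantumMatrix.mul {q : ℂˣ} {x y : Fin 2 → Fin 2 → B} (hx : IsQuantumMatrix q x)
    (hy : IsQuantumMatrix q y) (hxy : ∀ i j k l, y i j * x k l = x k l * y i j) :
    IsQuantumMatrix q fun i k => ∑ l, x i l * y l k := by
  have hq : (q : ℂ) ≠ 0 := q.ne_zero
  obtain ⟨ba, ca, db, dc, cb, da, det⟩ := hx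
  obtain ⟨ba', ca', db', dc', cb', da', det'⟩ := hy
  replace det := sub_eq_iff_eq_add.1 det
  replace det' := sub_eq_iff_eq_add.1 det'
  replace da := sub_eq_iff_eq_add.1 da
  replace da' := sub_eq_iff_eq_add.1 da'
  rw [det] at da
  rw [det'] at da'
  -- Every relation is used both at the end of a word and followed by a further factor.
  have assoc {u v w : B} (h : u * v = w) (z : B) : u * (v * z) = w * z := by rw [← mul_assoc, h]
  have hxy' (i j k l) (z : B) := assoc (hxy i j k l) z
  constructor <;>
  · simp only [Fin.sum_univ_two, mul_add, add_mul, mul_assoc, hxy']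
    simp only [ba, dc, cb, da, det, assoc ba, assoc ca, assoc db, assoc dc, assoc cb, assoc da,
      assoc det, ba', ca', db', dc', cb', da', det', smul_mul_assoc, mul_smul_comm, add_mul,
      mul_add, one_mul, mul_one, smul_add, smul_smul, mul_assoc, mu]
    match_scalars <;> field_simp <;> ring

/-- The case `v² = 0` of the `q`-binomial theorem. -/
lemma add_pow_of_mul_eq_smul {u v : B} {s : ℂ} (h : v * u = s • (u * v)) (hv : v * v = 0) (n : ℕ) :
    (u + v) ^ (n + 1) = u ^ (n + 1) + (∑ i ∈ Finset.range (n + 1), s ^ i) • (u ^ n * v) := by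
  induction n with
  | zero => simp
  | succ n ih =>
    rw [pow_succ, ih, geom_sum_succ (n := n + 1)]
    have h1 : u ^ n * v * u = s • (u ^ (n + 1) * v) := by
      rw [mul_assoc, h, mul_smul_comm, ← mul_assoc, ← pow_succ]
    have h2 : u ^ n * v * v = 0 := by rw [mul_assoc, hv, mul_zero]
    simp only [mul_add, add_mul, smul_mul_assoc, h1, h2, ← pow_succ]
    module

lemma add_pow_eq_of_isPrimitiveRoot {u v : B} {s : ℂ} {r : ℕ} (hr : 1 < r)
    (hs : IsPrimitiveRoot s r) (h : v * u = s • (u * v)) (hv : v * v = 0) :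
    (u + v) ^ r = u ^ r := by
  obtain ⟨n, rfl⟩ : ∃ n, r = n + 1 := ⟨r - 1, by omega⟩
  rw [add_pow_of_mul_eq_smul h hv, hs.geom_sum_eq_zero hr, zero_smul, add_zero]

end quantumMatrix

lemma isQuantumMatrix_act (q : ℂˣ) : IsQuantumMatrix q (act q) := by
  have hq : (q : ℂ) ≠ 0 := q.ne_zero
  have h1 : (1 : Matrix (Fin 4) (Fin 4) ℂ) =
      !![1, 0, 0, 0; 0, 1, 0, 0; 0, 0, 1, 0; 0, 0, 0, 1] := by
    ext a b; fin_cases a <;> fin_cases b <;> rfl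
  constructor <;> try rw [h1]
  all_goals simp [act]
  all_goals (repeat' apply And.intro)
  all_goals (try simp only [mu])
  all_goals try field_simp
  all_goals try ring1
  all_goals (ext j; fin_cases j <;> rfl)

lemma isQuantumMatrix_t (q : ℂˣ) (r : ℕ) : IsQuantumMatrix q (t q r) where
  ba := by
    have h := mk_rel q r (Rel.ba (q := q) (r := r))
    simp only [map_mul, map_smul] at h
    exact h
  ca := by
    have h := mk_rel q r (Rel.ca (q := q) (r := r))
    simp only [map_mul, map_smul] at h
    exact h
  db := by
    have h := mk_rel q r (Rel.db (q := q) (r := r))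
    simp only [map_mul, map_smul] at h
    exact h
  dc := by
    have h := mk_rel q r (Rel.dc (q := q) (r := r))
    simp only [map_mul, map_smul] at h
    exact h
  cb := by
    have h := mk_rel q r (Rel.cb (q := q) (r := r))
    simp only [map_mul] at h
    exact h
  da := by
    have h := mk_rel q r (Rel.da (q := q) (r := r))
    simp only [map_mul, map_smul, map_sub] at h
    exact h
  det := by
    have h := mk_rel q r (Rel.det (q := q) (r := r))
    simp only [map_mul, map_smul, map_sub, map_one] at h
    exact h

lemma act_zero_zero_pow (q : ℂˣ) (n : ℕ) : act q 0 0 ^ n =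
    !![(q : ℂ) ^ n, 0, 0, 0; 0, 1, 0, 0; 0, 0, 1, 0;
      mu q * ((q : ℂ) ^ n - (q : ℂ)⁻¹ ^ n), 0, 0, (q : ℂ)⁻¹ ^ n] := by
  have hq : (q : ℂ) ≠ 0 := q.ne_zero
  induction n with
  | zero => ext a b; fin_cases a <;> fin_cases b <;> simp
  | succ n ih =>
    rw [pow_succ, ih]
    simp [act, pow_succ]
    simp only [mu]; field_simp; ring

lemma act_one_one_pow (q : ℂˣ) (n : ℕ) : act q 1 1 ^ n =
    !![(q : ℂ)⁻¹ ^ n, 0, 0, 0; 0, 1, 0, 0; 0, 0, 1, 0; 0, 0, 0, (q : ℂ) ^ n] := by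
  induction n with
  | zero => ext a b; fin_cases a <;> fin_cases b <;> simp
  | succ n ih =>
    rw [pow_succ, ih]
    simp [act, pow_succ]

/-! ### Representations of `Ω` and the coaction -/

lemma wordEval_e_eq_zero (q : ℂˣ) (r n : ℕ) {x : Tens n} (hx : antisym q n x = 0) :
    wordEval (e q r) n x = 0 := by
  have h := mk_rel q r (Rel.ext (r := r) n x hx)
  rw [map_sum, map_zero] at h
  rw [wordEval_eq_sum, ← h]
  refine Finset.sum_congr rfl fun w _ => ?_
  rw [map_smul, map_list_prod, List.map_ofFn]
  rfl

section lift

variable {B : Type*} [Ring B] [Algebra ℂ B]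

/-- The map on generators with values `T` on the functions and `E` on the basis 1-forms. -/
def genMap (T : Fin 2 → Fin 2 → B) (E : Fin 4 → B) : Gen → B
  | .t i k => T i k
  | .e p => E p

/-- The elements `T` and `E` of an algebra satisfy the defining relations of `Ω`. -/
structure IsOmegaRep (q : ℂˣ) (r : ℕ) (T : Fin 2 → Fin 2 → B) (E : Fin 4 → B) : Prop where
  isQuantumMatrix : IsQuantumMatrix q T
  pow_a : T 0 0 ^ r = 1
  pow_b : T 0 1 ^ r = 0
  pow_c : T 1 0 ^ r = 0
  pow_d : T 1 1 ^ r = 1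
  cross (i k : Fin 2) (p : Fin 4) : T i k * E p = ∑ l, ∑ s, act q i l s p • (E s * T l k)
  ext (n : ℕ) (x : Tens n) : antisym q n x = 0 → wordEval E n x = 0

variable {q : ℂˣ} {r : ℕ} {T : Fin 2 → Fin 2 → B} {E : Fin 4 → B}

lemma IsOmegaRep.lift_eq (h : IsOmegaRep q r T E) {x y : FreeAlgebra ℂ Gen} (hxy : Rel q r x y) :
    FreeAlgebra.lift ℂ (genMap T E) x = FreeAlgebra.lift ℂ (genMap T E) y := by
  obtain ⟨⟨ba, ca, db, dc, cb, da, det⟩, pow_a, pow_b, pow_c, pow_d, cross, ext⟩ := h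
  cases hxy with
  | ext n x hx =>
    rw [map_sum, map_zero, ← ext n x hx, wordEval_eq_sum]
    refine Finset.sum_congr rfl fun w _ => ?_
    rw [map_smul, map_list_prod, List.map_ofFn]
    congr 3
    funext m
    simp [genMap]
  | cross i k p => simpa [genMap, Fin.sum_univ_two] using cross i k p
  | _ => simpa [genMap]

/-- The algebra map out of `Ω` with prescribed values on the generators. -/
def IsOmegaRep.lift (h : IsOmegaRep q r T E) : Omega q r →ₐ[ℂ] B :=
  RingQuot.liftAlgHom ℂ ⟨FreeAlgebra.lift ℂ (genMap T E), fun _ _ hxy => h.lift_eq hxy⟩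

lemma IsOmegaRep.lift_mk (h : IsOmegaRep q r T E) (x : FreeAlgebra ℂ Gen) :
    h.lift (QSL2.mk q r x) = FreeAlgebra.lift ℂ (genMap T E) x :=
  RingQuot.liftAlgHom_mkAlgHom_apply ℂ _ _ _

lemma IsOmegaRep.lift_t (h : IsOmegaRep q r T E) (i k : Fin 2) : h.lift (t q r i k) = T i k := by
  rw [t, h.lift_mk, FreeAlgebra.lift_ι_apply, genMap]

lemma IsOmegaRep.lift_e (h : IsOmegaRep q r T E) (p : Fin 4) : h.lift (e q r p) = E p := by
  rw [e, h.lift_mk, FreeAlgebra.lift_ι_apply, genMap]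

end lift

lemma isOmegaRep_self (q : ℂˣ) (r : ℕ) : IsOmegaRep q r (t q r) (e q r) where
  isQuantumMatrix := isQuantumMatrix_t q r
  pow_a := by have h := mk_rel q r (Rel.pow_a (q := q) (r := r)); rwa [map_pow, map_one] at h
  pow_b := by have h := mk_rel q r (Rel.pow_b (q := q) (r := r)); rwa [map_pow, map_zero] at h
  pow_c := by have h := mk_rel q r (Rel.pow_c (q := q) (r := r)); rwa [map_pow, map_zero] at h
  pow_d := by have h := mk_rel q r (Rel.pow_d (q := q) (r := r)); rwa [map_pow, map_one] at h
  cross i k p := by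
    have h := mk_rel q r (Rel.cross (q := q) (r := r) i k p)
    simp only [map_sum, map_mul, map_smul] at h
    exact h
  ext n x hx := wordEval_e_eq_zero q r n hx

@[elab_as_elim]
lemma Omega.induction {q : ℂˣ} {r : ℕ} {P : Omega q r → Prop}
    (algebraMap : ∀ c : ℂ, P (algebraMap ℂ (Omega q r) c))
    (t : ∀ i k, P (t q r i k)) (e : ∀ p, P (e q r p))
    (mul : ∀ x y, P x → P y → P (x * y)) (add : ∀ x y, P x → P y → P (x + y)) (x : Omega q r) :
    P x := by
  obtain ⟨x, rfl⟩ := RingQuot.mkAlgHom_surjective ℂ (Rel q r) x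
  change P (mk q r x)
  induction x using FreeAlgebra.induction with
  | grade0 c => rw [AlgHom.commutes]; exact algebraMap c
  | grade1 g =>
    cases g with
    | t i k => exact t i k
    | e p => exact e p
  | mul x y hx hy => rw [map_mul]; exact mul _ _ hx hy
  | add x y hx hy => rw [map_add]; exact add _ _ hx hy

section coactRep

variable {B : Type*} [Ring B] [Algebra ℂ B]

lemma ten_smul_left (a : ℂ) (c : Matrix (Fin 4) (Fin 4) ℂ) (b : B) :
    ten (a • c) b = a • ten c b := by
  ext p s; simp only [ten_apply, Matrix.smul_apply, smul_eq_mul, mul_smul]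

lemma ten_smul_right (a : ℂ) (c : Matrix (Fin 4) (Fin 4) ℂ) (b : B) :
    ten c (a • b) = a • ten c b := by
  ext p s; simp only [ten_apply, Matrix.smul_apply, smul_comm a]

lemma ten_sum_left {ι : Type*} (f : Finset ι) (c : ι → Matrix (Fin 4) (Fin 4) ℂ) (b : B) :
    ten (∑ i ∈ f, c i) b = ∑ i ∈ f, ten (c i) b := by
  ext p s; simp only [ten_apply, Matrix.sum_apply, Finset.sum_smul]

lemma ten_sum_right {ι : Type*} (f : Finset ι) (c : Matrix (Fin 4) (Fin 4) ℂ) (b : ι → B) :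
    ten c (∑ i ∈ f, b i) = ∑ i ∈ f, ten c (b i) := by
  ext p s; simp only [ten_apply, Matrix.sum_apply, Finset.smul_sum]

lemma ten_one_one : ten (1 : Matrix (Fin 4) (Fin 4) ℂ) (1 : B) = 1 := by
  ext p s; simp only [ten_apply, Matrix.one_apply]; split_ifs <;> simp

lemma ten_zero_left (b : B) : ten 0 b = 0 := by
  ext p s; simp [ten_apply]

lemma ten_zero_right (c : Matrix (Fin 4) (Fin 4) ℂ) : ten c (0 : B) = 0 := by
  ext p s; simp [ten_apply]

lemma ten_sub_left (c c' : Matrix (Fin 4) (Fin 4) ℂ) (b : B) :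
    ten (c - c') b = ten c b - ten c' b := by
  ext p s; simp only [ten_apply, Matrix.sub_apply, sub_smul]

lemma ten_sub_right (c : Matrix (Fin 4) (Fin 4) ℂ) (b b' : B) :
    ten c (b - b') = ten c b - ten c b' := by
  ext p s; simp only [ten_apply, Matrix.sub_apply, smul_sub]

lemma ten_pow (c : Matrix (Fin 4) (Fin 4) ℂ) (b : B) (n : ℕ) :
    ten c b ^ n = ten (c ^ n) (b ^ n) := by
  induction n with
  | zero => simp only [pow_zero, ten_one_one]
  | succ n ih => rw [pow_succ, ih, ten_mul_ten, pow_succ, pow_succ]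

lemma IsQuantumMatrix.ten {q : ℂˣ} {y : Fin 2 → Fin 2 → B} (hy : IsQuantumMatrix q y) :
    IsQuantumMatrix q fun i k => ∑ l, QSL2.ten (act q i l) (y l k) := by
  obtain ⟨ba, ca, db, dc, cb, da, det⟩ := isQuantumMatrix_act q
  have h1 : IsQuantumMatrix q fun i k => QSL2.ten (act q i k) (1 : B) := by
    constructor <;> simp only [ten_mul_ten, mul_one, ← ten_smul_left, ← ten_sub_left, ba, ca, db,
      dc, cb, da, det, ten_one_one]
  obtain ⟨ba, ca, db, dc, cb, da, det⟩ := hy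
  have h2 : IsQuantumMatrix q fun i k => QSL2.ten 1 (y i k) := by
    constructor <;> simp only [ten_mul_ten, mul_one, ← ten_smul_right, ← ten_sub_right, ba, ca, db,
      dc, cb, da, det, ten_one_one]
  have h := h1.mul h2 fun i j k l => by simp only [ten_mul_ten, one_mul, mul_one]
  simpa only [ten_mul_ten, one_mul, mul_one] using h

end coactRep

/-- The coaction of `t^i_k` with its left factor acting on `Λ¹`. -/
def coactT (q : ℂˣ) (r : ℕ) (i k : Fin 2) : Matrix (Fin 4) (Fin 4) (Omega q r) :=
  ∑ l, ten (act q i l) (t q r l k)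

/-- The coaction of `e_p` with its left factor acting on `Λ¹`. -/
def coactE (q : ℂˣ) (r : ℕ) (p : Fin 4) : Matrix (Fin 4) (Fin 4) (Omega q r) :=
  ∑ y, ten (coactMat q y p) (e q r y)

lemma coactT_mul_coactE (q : ℂˣ) (r : ℕ) (i k : Fin 2) (p : Fin 4) :
    coactT q r i k * coactE q r p = ∑ l, ∑ s, act q i l s p • (coactE q r s * coactT q r l k) := by
  simp only [coactT, coactE, Finset.sum_mul_sum, ten_mul_ten, (isOmegaRep_self q r).cross,
    ten_sum_right, ten_smul_right, Finset.smul_sum, ← ten_smul_left]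
  trans ∑ y, ∑ m, ten (∑ l, ∑ s, act q l m y s • (act q i l * coactMat q s p))
    (e q r y * t q r m k)
  · simp only [ten_sum_left]
    rw [sum_comm_four]
    rw [Finset.sum_comm]
  · simp only [sum_act_smul_act_mul_coactMat, ten_sum_left]
    rw [sum_comm_four]

lemma act_zero_one_mul_self (q : ℂˣ) : act q 0 1 * act q 0 1 = 0 := by
  ext a b; fin_cases a <;> fin_cases b <;> simp [act]

lemma act_one_zero_mul_self (q : ℂˣ) : act q 1 0 * act q 1 0 = 0 := by
  ext a b; fin_cases a <;> fin_cases b <;> simp [act]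

lemma act_zero_zero_pow_eq_one {q : ℂˣ} {r : ℕ} (hq : (q : ℂ) ^ r = 1) : act q 0 0 ^ r = 1 := by
  rw [act_zero_zero_pow, inv_pow, hq]
  ext a b; fin_cases a <;> fin_cases b <;> simp

lemma act_one_one_pow_eq_one {q : ℂˣ} {r : ℕ} (hq : (q : ℂ) ^ r = 1) : act q 1 1 ^ r = 1 := by
  rw [act_one_one_pow, inv_pow, hq]
  ext a b; fin_cases a <;> fin_cases b <;> simp

/-- The left coaction of `A` on `Ω`, composed with the action of `A` on `Λ¹`, is a well-defined
algebra map `Ω → M₄(Ω)`. The relations in `ker A_n` hold because `ker A_n` is a subcomodule, and the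
`r`-th powers by the `q`-binomial theorem, `q²` being a primitive `r`-th root of unity for odd `r`.
-/
lemma isOmegaRep_coact {q : ℂˣ} {r : ℕ} (hr : 1 < r) (hodd : Odd r)
    (hq : IsPrimitiveRoot (q : ℂ) r) :
    IsOmegaRep q r (coactT q r) (coactE q r) := by
  have hq0 : (q : ℂ) ≠ 0 := q.ne_zero
  have h2 : IsPrimitiveRoot ((q : ℂ) ^ 2) r :=
    hq.pow_of_coprime 2 (Nat.coprime_two_left.2 hodd)
  have h2' : IsPrimitiveRoot (((q : ℂ) ^ 2)⁻¹) r := h2.inv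
  obtain ⟨ba, ca, db, dc, cb, da, det⟩ := isQuantumMatrix_act q
  obtain ⟨⟨ba', ca', db', dc', cb', da', det'⟩, pow_a, pow_b, pow_c, pow_d, -, -⟩ :=
    isOmegaRep_self q r
  refine ⟨(isQuantumMatrix_t q r).ten, ?_, ?_, ?_, ?_, coactT_mul_coactE q r, fun n x hx => ?_⟩
  · rw [coactT, Fin.sum_univ_two, add_pow_eq_of_isPrimitiveRoot hr h2, ten_pow, pow_a,
      act_zero_zero_pow_eq_one hq.pow_eq_one, ten_one_one]
    · rw [ten_mul_ten, ten_mul_ten, ba, ca', ten_smul_left, ten_smul_right, smul_smul, sq]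
    · rw [ten_mul_ten, act_zero_one_mul_self, ten_zero_left]
  · rw [coactT, Fin.sum_univ_two, add_pow_eq_of_isPrimitiveRoot hr h2, ten_pow, pow_b,
      ten_zero_right]
    · rw [ten_mul_ten, ten_mul_ten, ba, db', ten_smul_left, ten_smul_right, smul_smul, sq]
    · rw [ten_mul_ten, act_zero_one_mul_self, ten_zero_left]
  · rw [coactT, Fin.sum_univ_two, add_comm, add_pow_eq_of_isPrimitiveRoot hr h2', ten_pow, pow_c,
      ten_zero_right]
    · rw [ten_mul_ten, ten_mul_ten, dc, ca', ten_smul_left, ten_smul_right, smul_smul, smul_smul,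
        mul_assoc, ← sq, inv_mul_cancel₀ (pow_ne_zero 2 hq0), one_smul]
    · rw [ten_mul_ten, act_one_zero_mul_self, ten_zero_left]
  · rw [coactT, Fin.sum_univ_two, add_comm, add_pow_eq_of_isPrimitiveRoot hr h2', ten_pow, pow_d,
      act_one_one_pow_eq_one hq.pow_eq_one, ten_one_one]
    · rw [ten_mul_ten, ten_mul_ten, dc, db', ten_smul_left, ten_smul_right, smul_smul, smul_smul,
        mul_assoc, ← sq, inv_mul_cancel₀ (pow_ne_zero 2 hq0), one_smul]
    · rw [ten_mul_ten, act_one_zero_mul_self, ten_zero_left]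
  · ext p s
    refine (wordEval_ten q (e q r) n x p s).trans (wordEval_e_eq_zero q r n ?_)
    rw [← coact_antisym, hx, map_zero]

/-! ### Block triangular matrices -/

section blk

variable {B : Type*} [Ring B]

/-- The block triangular matrix with diagonal blocks `X`, `b` and upper right block `v`. -/
def blk (X : Matrix (Fin 4) (Fin 4) B) (v : Fin 4 → B) (b : B) :
    Matrix (Fin 4 ⊕ Unit) (Fin 4 ⊕ Unit) B :=
  Matrix.fromBlocks X (Matrix.of fun p _ => v p) 0 (Matrix.of fun _ _ => b)

lemma blk_mul (X Y : Matrix (Fin 4) (Fin 4) B) (v w : Fin 4 → B) (b c : B) :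
    blk X v b * blk Y w c = blk (X * Y) (fun p => ∑ s, X p s * w s + v p * c) (b * c) := by
  rw [blk, blk, blk, Matrix.fromBlocks_multiply]
  congr 1
  · simp
  · ext p j; simp [Matrix.mul_apply]
  · simp
  · ext i j; simp [Matrix.mul_apply]

lemma blk_add (X Y : Matrix (Fin 4) (Fin 4) B) (v w : Fin 4 → B) (b c : B) :
    blk X v b + blk Y w c = blk (X + Y) (v + w) (b + c) := by
  ext (p | p) (s | s) <;> simp [blk]

lemma blk_sub (X Y : Matrix (Fin 4) (Fin 4) B) (v w : Fin 4 → B) (b c : B) :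
    blk X v b - blk Y w c = blk (X - Y) (v - w) (b - c) := by
  ext (p | p) (s | s) <;> simp [blk]

lemma smul_blk [Algebra ℂ B] (a : ℂ) (X : Matrix (Fin 4) (Fin 4) B) (v : Fin 4 → B) (b : B) :
    a • blk X v b = blk (a • X) (a • v) (a • b) := by
  ext (p | p) (s | s) <;> simp [blk]

lemma blk_one : blk (1 : Matrix (Fin 4) (Fin 4) B) 0 1 = 1 := by
  ext (p | p) (s | s) <;> simp [blk, Matrix.one_apply]

lemma blk_zero : blk (0 : Matrix (Fin 4) (Fin 4) B) 0 0 = 0 := by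
  ext (p | p) (s | s) <;> simp [blk]

lemma blk_sum {ι : Type*} (f : Finset ι) (X : ι → Matrix (Fin 4) (Fin 4) B) (v : ι → Fin 4 → B)
    (b : ι → B) : ∑ i ∈ f, blk (X i) (v i) (b i) = blk (∑ i ∈ f, X i) (∑ i ∈ f, v i)
      (∑ i ∈ f, b i) := by
  ext (p | p) (s | s) <;> simp [blk, Matrix.sum_apply]

lemma blk_diag_mul (X Y : Matrix (Fin 4) (Fin 4) B) (b c : B) :
    blk X 0 b * blk Y 0 c = blk (X * Y) 0 (b * c) := by
  rw [blk_mul]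
  congr 1
  funext p
  simp

lemma blk_diag_pow (X : Matrix (Fin 4) (Fin 4) B) (b : B) (n : ℕ) :
    blk X 0 b ^ n = blk (X ^ n) 0 (b ^ n) := by
  induction n with
  | zero => simp only [pow_zero, blk_one]
  | succ n ih => rw [pow_succ, ih, blk_diag_mul, pow_succ, pow_succ]

end blk

/-! ### Contractions on generators -/

/-- The image of `t^i_k` under the algebra map that encodes the contractions: functions contract to
zero, so it is block diagonal. -/
def contrT (q : ℂˣ) (r : ℕ) (i k : Fin 2) : Matrix (Fin 4 ⊕ Unit) (Fin 4 ⊕ Unit) (Omega q r) :=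
  blk (coactT q r i k) 0 (t q r i k)

/-- The image of `e_p` under the algebra map that encodes the contractions. The upper right block
says that the `s`-th contraction of `e_p` is `1` if `s = p` and `0` otherwise; the sign in the upper
left block makes the contractions odd derivations. -/
def contrE (q : ℂˣ) (r : ℕ) (p : Fin 4) : Matrix (Fin 4 ⊕ Unit) (Fin 4 ⊕ Unit) (Omega q r) :=
  blk (-coactE q r p) (Pi.single p 1) (e q r p)

/-- The contractions of a tensor: the first tensor factor of `[n, -Ψ]`, the rest evaluated in `Ω`.
-/
def wordContr (q : ℂˣ) (r : ℕ) : (n : ℕ) → Tens n → Fin 4 → Omega q r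
  | 0, _, _ => 0
  | n + 1, x, p => wordEval (e q r) n (slice p (braidedInt q (n + 1) x))

/-- The recursion `[n + 1, -Ψ] = id - Ψ₁₂ (id ⊗ [n, -Ψ])` is a twisted Leibniz rule. -/
lemma wordContr_succ (q : ℂˣ) (r n : ℕ) (x : Tens (n + 1)) (p : Fin 4) :
    wordContr q r (n + 1) x p = wordEval (e q r) n (slice p x) -
      ∑ z, ∑ u, coactE q r z p u * wordContr q r n (slice z x) u := by
  cases n with
  | zero => simp [wordContr, braidedInt]
  | succ n =>
    rw [wordContr, braidedInt, LinearMap.sub_apply, map_sub, map_sub, LinearMap.id_apply]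
    congr 1
    simp only [wordEval_succ _ n, LinearMap.comp_apply, slice_slice_psi12, slice_idTensor, map_sum,
      map_smul, wordContr, coactE, Matrix.sum_apply, ten_apply, Finset.mul_sum, Finset.sum_mul,
      mul_smul_comm, smul_mul_assoc, braid_apply]
    exact sum_comm_three _

lemma wordEval_contrE (q : ℂˣ) (r n : ℕ) (x : Tens n) : wordEval (contrE q r) n x =
    blk ((-1 : ℂ) ^ n • wordEval (coactE q r) n x) (wordContr q r n x) (wordEval (e q r) n x) := by
  induction n with
  | zero =>
    simp only [wordEval_zero, pow_zero, one_smul, ← blk_one, smul_blk]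
    congr 1
    funext p
    simp [wordContr]
  | succ n ih =>
    simp only [wordEval_succ _ n, ih, contrE, blk_mul, blk_sum]
    congr 1
    · simp [pow_succ, Finset.smul_sum]
    · funext p
      rw [wordContr_succ]
      simp [Pi.single_apply, neg_add_eq_sub]

/-- The contractions are well defined on `Ω`: since `A_n = (id ⊗ A_{n-1}) [n, -Ψ]`, the braided
integer maps `ker A_n` to `Λ¹ ⊗ ker A_{n-1}`. -/
lemma isOmegaRep_contr {q : ℂˣ} {r : ℕ} (h : IsOmegaRep q r (coactT q r) (coactE q r)) :
    IsOmegaRep q r (contrT q r) (contrE q r) := by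
  obtain ⟨⟨ba, ca, db, dc, cb, da, det⟩, pow_a, pow_b, pow_c, pow_d, cross, ext⟩ := h
  obtain ⟨⟨ba', ca', db', dc', cb', da', det'⟩, pow_a', pow_b', pow_c', pow_d', cross', ext'⟩ :=
    isOmegaRep_self q r
  refine ⟨?_, ?_, ?_, ?_, ?_, fun i k p => ?_, fun n x hx => ?_⟩
  · constructor <;> simp only [contrT, blk_diag_mul, smul_blk, blk_sub, ba, ca, db, dc, cb, da,
      det, ba', ca', db', dc', cb', da', det', smul_zero, sub_zero, blk_one]
  · rw [contrT, blk_diag_pow, pow_a, pow_a', blk_one]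
  · rw [contrT, blk_diag_pow, pow_b, pow_b', blk_zero]
  · rw [contrT, blk_diag_pow, pow_c, pow_c', blk_zero]
  · rw [contrT, blk_diag_pow, pow_d, pow_d', blk_one]
  · simp only [contrT, contrE, blk_mul, smul_blk, blk_sum]
    congr 1
    · simp only [mul_neg, neg_mul, cross, smul_neg, Finset.sum_neg_distrib]
    · funext a
      simp [coactT, Matrix.sum_apply, ten_apply, Pi.single_apply]
    · exact cross' i k p
  · rw [wordEval_contrE, ext n x hx, ext' n x hx, smul_zero, ← blk_zero]
    congr 1
    funext p
    cases n with
    | zero => rfl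
    | succ n =>
      rw [antisym, LinearMap.comp_apply] at hx
      refine ext' n _ ?_
      rw [← slice_idTensor, hx, map_zero]

/-! ### Convolution operators and contractions on `Ω` -/

section operators

variable {q : ℂˣ} {r : ℕ} (h : IsOmegaRep q r (coactT q r) (coactE q r))

include h

/-- The algebra map `ω ↦ ρ(ω⁽¹⁾) ⊗ ω⁽²⁾`, for the left coaction on `Ω` and the representation `ρ` of
`A` on `Λ¹`. -/
def coactHom : Omega q r →ₐ[ℂ] Matrix (Fin 4) (Fin 4) (Omega q r) := h.lift

/-- The convolution operator `ω ↦ ρ(ω⁽¹⁾)_{ps} ω⁽²⁾` of a matrix entry of `ρ`. -/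
def convOp (p s : Fin 4) : Omega q r →ₗ[ℂ] Omega q r :=
  Matrix.entryLinearMap ℂ (Omega q r) p s ∘ₗ (coactHom h).toLinearMap

lemma convOp_apply (p s : Fin 4) (x : Omega q r) : convOp h p s x = coactHom h x p s := rfl

lemma convOp_mul (p s : Fin 4) (x y : Omega q r) :
    convOp h p s (x * y) = ∑ u, convOp h p u x * convOp h u s y := by
  simp only [convOp_apply, map_mul, Matrix.mul_apply]

lemma convOp_t (p s : Fin 4) (i k : Fin 2) :
    convOp h p s (t q r i k) = ∑ l, act q i l p s • t q r l k := by
  rw [convOp_apply, coactHom, h.lift_t]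
  simp only [coactT, Matrix.sum_apply, ten_apply]

lemma convOp_e (p s x : Fin 4) :
    convOp h p s (e q r x) = ∑ y, coactMat q y x p s • e q r y := by
  rw [convOp_apply, coactHom, h.lift_e]
  simp only [coactE, Matrix.sum_apply, ten_apply]

lemma convOp_algebraMap (p s : Fin 4) (c : ℂ) :
    convOp h p s (algebraMap ℂ (Omega q r) c) =
      if p = s then algebraMap ℂ (Omega q r) c else 0 := by
  rw [convOp_apply, AlgHom.commutes, Matrix.algebraMap_matrix_apply]

lemma convOp_mem_invForms (p s : Fin 4) {x : Omega q r} (hx : x ∈ invForms q r) :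
    convOp h p s x ∈ invForms q r := by
  rw [invForms] at hx
  induction hx using Submodule.span_induction with
  | mem x hx =>
    obtain ⟨y, rfl⟩ := hx
    rw [convOp_e]
    exact sum_mem fun y _ => Submodule.smul_mem _ _ (Submodule.subset_span ⟨y, rfl⟩)
  | zero => rw [map_zero]; exact zero_mem _
  | add x y _ _ hx hy => rw [map_add]; exact add_mem hx hy
  | smul c x _ hx => rw [map_smul]; exact Submodule.smul_mem _ _ hx

lemma convOp_mem_functions (p s : Fin 4) {x : Omega q r} (hx : x ∈ functions q r) :
    convOp h p s x ∈ functions q r := by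
  induction hx using Algebra.adjoin_induction generalizing p s with
  | mem x hx =>
    obtain ⟨⟨i, k⟩, rfl⟩ := hx
    rw [convOp_t]
    exact sum_mem fun l _ => (functions q r).smul_mem (Algebra.subset_adjoin ⟨(l, k), rfl⟩) _
  | algebraMap c =>
    rw [convOp_algebraMap]
    split_ifs
    · exact Subalgebra.algebraMap_mem _ c
    · exact zero_mem _
  | add x y _ _ hx hy => rw [map_add]; exact add_mem (hx p s) (hy p s)
  | mul x y _ _ hx hy => rw [convOp_mul]; exact sum_mem fun u _ => mul_mem (hx p u) (hy u s)

omit h in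
lemma forms_zero (q : ℂˣ) (r : ℕ) : forms q r 0 = Subalgebra.toSubmodule (functions q r) := by
  rw [forms, pow_zero, one_mul]

omit h in
lemma forms_succ (q : ℂˣ) (r n : ℕ) : forms q r (n + 1) = invForms q r * forms q r n := by
  rw [forms, forms, pow_succ', mul_assoc]

lemma convOp_mem_forms (n : ℕ) (p s : Fin 4) {x : Omega q r} (hx : x ∈ forms q r n) :
    convOp h p s x ∈ forms q r n := by
  induction n generalizing p s x with
  | zero =>
    rw [forms_zero] at hx ⊢
    exact convOp_mem_functions h p s hx
  | succ n ih =>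
    rw [forms_succ] at hx ⊢
    induction hx using Submodule.mul_induction_on' with
    | mem_mul_mem v hv y hy =>
      rw [convOp_mul]
      exact sum_mem fun u _ => Submodule.mul_mem_mul (convOp_mem_invForms h p u hv) (ih u s hy)
    | add x _ y _ hx hy => rw [map_add]; exact add_mem hx hy

/-- The algebra map whose upper right block holds the contractions. -/
def contrHom : Omega q r →ₐ[ℂ] Matrix (Fin 4 ⊕ Unit) (Fin 4 ⊕ Unit) (Omega q r) :=
  (isOmegaRep_contr h).lift

/-- The contraction of a form with the basis vector dual to `e_p`. -/
def contr (p : Fin 4) : Omega q r →ₗ[ℂ] Omega q r :=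
  Matrix.entryLinearMap ℂ (Omega q r) (Sum.inl p) (Sum.inr ()) ∘ₗ (contrHom h).toLinearMap

lemma contr_apply_of_eq {x y : Omega q r} {X : Matrix (Fin 4) (Fin 4) (Omega q r)}
    {v : Fin 4 → Omega q r} (hx : contrHom h x = blk X v y) (p : Fin 4) : contr h p x = v p :=
  congrFun (congrFun hx (Sum.inl p)) (Sum.inr ())

lemma contrHom_eq_blk (x : Omega q r) :
    ∃ X, contrHom h x = blk X (fun p => contr h p x) x := by
  suffices ∃ X v, contrHom h x = blk X v x by
    obtain ⟨X, v, hX⟩ := this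
    exact ⟨X, by rw [hX]; congr 1; funext p; exact (contr_apply_of_eq h hX p).symm⟩
  induction x using Omega.induction with
  | algebraMap c =>
    exact ⟨c • 1, c • 0, by rw [AlgHom.commutes, Algebra.algebraMap_eq_smul_one,
      Algebra.algebraMap_eq_smul_one, ← smul_blk, blk_one]⟩
  | t i k => exact ⟨_, _, (isOmegaRep_contr h).lift_t i k⟩
  | e p => exact ⟨_, _, (isOmegaRep_contr h).lift_e p⟩
  | mul x y hx hy =>
    obtain ⟨X, v, hX⟩ := hx
    obtain ⟨Y, w, hY⟩ := hy
    exact ⟨_, _, by rw [map_mul, hX, hY, blk_mul]⟩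
  | add x y hx hy =>
    obtain ⟨X, v, hX⟩ := hx
    obtain ⟨Y, w, hY⟩ := hy
    exact ⟨_, _, by rw [map_add, hX, hY, blk_add]⟩

/-- The forms on which the upper left block of `contrHom` is `(-1)ⁿ` times the coaction. -/
def signedForms (n : ℕ) : Submodule ℂ (Omega q r) where
  carrier := {x | contrHom h x = blk ((-1 : ℂ) ^ n • coactHom h x) (fun p => contr h p x) x}
  zero_mem' := by
    change _ = _
    simp only [map_zero, smul_zero]
    exact blk_zero.symm
  add_mem' := fun {x y} hx hy => by
    change _ = _
    rw [map_add, hx, hy, blk_add]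
    simp only [map_add, smul_add]
    rfl
  smul_mem' := fun c x hx => by
    change _ = _
    rw [map_smul, hx, smul_blk]
    simp only [map_smul, smul_comm c]
    rfl

lemma mem_signedForms {n : ℕ} {x : Omega q r} : x ∈ signedForms h n ↔
    contrHom h x = blk ((-1 : ℂ) ^ n • coactHom h x) (fun p => contr h p x) x := Iff.rfl

lemma mem_signedForms_of_eq {n : ℕ} {x : Omega q r} {v : Fin 4 → Omega q r}
    (hx : contrHom h x = blk ((-1 : ℂ) ^ n • coactHom h x) v x) : x ∈ signedForms h n := by
  rw [mem_signedForms, hx]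
  congr 1
  funext p
  exact (contr_apply_of_eq h hx p).symm

lemma mul_mem_signedForms {m n : ℕ} {x y : Omega q r} (hx : x ∈ signedForms h m)
    (hy : y ∈ signedForms h n) : x * y ∈ signedForms h (m + n) := by
  rw [mem_signedForms] at hx hy
  apply mem_signedForms_of_eq
  rw [map_mul, hx, hy, blk_mul, map_mul, smul_mul_smul_comm, ← pow_add]

lemma e_mem_signedForms (p : Fin 4) : e q r p ∈ signedForms h 1 := by
  apply mem_signedForms_of_eq (v := Pi.single p 1)
  rw [coactHom, h.lift_e, contrHom, IsOmegaRep.lift_e, contrE]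
  simp

lemma contrHom_of_mem_functions {x : Omega q r} (hx : x ∈ functions q r) :
    contrHom h x = blk (coactHom h x) 0 x := by
  induction hx using Algebra.adjoin_induction with
  | mem x hx =>
    obtain ⟨⟨i, k⟩, rfl⟩ := hx
    rw [coactHom, h.lift_t, contrHom, IsOmegaRep.lift_t, contrT]
  | algebraMap c =>
    rw [AlgHom.commutes, AlgHom.commutes, Algebra.algebraMap_eq_smul_one,
      Algebra.algebraMap_eq_smul_one, Algebra.algebraMap_eq_smul_one, ← blk_one, smul_blk,
      smul_zero]
  | add x y _ _ hx hy => rw [map_add, hx, hy, blk_add, map_add, add_zero]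
  | mul x y _ _ hx hy => rw [map_mul, hx, hy, blk_diag_mul, map_mul]

lemma forms_le_signedForms (n : ℕ) : forms q r n ≤ signedForms h n := by
  induction n with
  | zero =>
    rw [forms_zero]
    intro x hx
    apply mem_signedForms_of_eq (v := 0)
    rw [pow_zero, one_smul]
    exact contrHom_of_mem_functions h hx
  | succ n ih =>
    rw [forms_succ, Submodule.mul_le]
    intro v hv y hy
    rw [add_comm]
    refine mul_mem_signedForms h ?_ (ih hy)
    refine (Submodule.span_le.2 ?_ : invForms q r ≤ signedForms h 1) hv
    rintro _ ⟨p, rfl⟩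
    exact e_mem_signedForms h p

/-- The braided Leibniz rule for contractions. -/
lemma contr_mul {n : ℕ} {x : Omega q r} (hx : x ∈ forms q r n) (y : Omega q r) (p : Fin 4) :
    contr h p (x * y) = (-1 : ℂ) ^ n • ∑ s, convOp h p s x * contr h s y + contr h p x * y := by
  obtain ⟨Y, hY⟩ := contrHom_eq_blk h y
  have hX := (mem_signedForms h).1 (forms_le_signedForms h n hx)
  have hXY := (map_mul (contrHom h) x y).trans ((congrArg₂ _ hX hY).trans (blk_mul _ _ _ _ _ _))
  rw [contr_apply_of_eq h hXY]
  simp only [Matrix.smul_apply, smul_mul_assoc, ← Finset.smul_sum]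
  rfl

lemma contr_eq_zero {x : Omega q r} (hx : x ∈ forms q r 0) (p : Fin 4) : contr h p x = 0 := by
  rw [forms_zero] at hx
  exact contr_apply_of_eq h (contrHom_of_mem_functions h hx) p

lemma contr_e (p s : Fin 4) : contr h p (e q r s) = if p = s then 1 else 0 := by
  have : contrHom h (e q r s) = contrE q r s := IsOmegaRep.lift_e _ s
  rw [contr_apply_of_eq h this, Pi.single_apply]

omit h in
lemma mem_forms_one_of_mem_invForms {x : Omega q r} (hx : x ∈ invForms q r) : x ∈ forms q r 1 := by
  rw [forms_succ, ← mul_one x]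
  refine Submodule.mul_mem_mul hx ?_
  rw [forms_zero]
  exact one_mem (functions q r)

lemma exists_contr_eq_smul_one (p : Fin 4) {v : Omega q r} (hv : v ∈ invForms q r) :
    ∃ c : ℂ, contr h p v = c • 1 := by
  rw [invForms] at hv
  induction hv using Submodule.span_induction with
  | mem x hx =>
    obtain ⟨s, rfl⟩ := hx
    exact ⟨if p = s then 1 else 0, by rw [contr_e]; split_ifs <;> simp⟩
  | zero => exact ⟨0, by rw [map_zero, zero_smul]⟩
  | add x y _ _ hx hy =>
    obtain ⟨a, ha⟩ := hx
    obtain ⟨b, hb⟩ := hy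
    exact ⟨a + b, by rw [map_add, ha, hb, add_smul]⟩
  | smul c x _ hx =>
    obtain ⟨a, ha⟩ := hx
    exact ⟨c * a, by rw [map_smul, ha, mul_smul]⟩

lemma contr_mem_forms (n : ℕ) (p : Fin 4) {x : Omega q r} (hx : x ∈ forms q r (n + 1)) :
    contr h p x ∈ forms q r n := by
  induction n generalizing p x with
  | zero =>
    rw [forms_succ] at hx
    induction hx using Submodule.mul_induction_on' with
    | mem_mul_mem v hv y hy =>
      obtain ⟨c, hc⟩ := exists_contr_eq_smul_one h p hv
      rw [contr_mul h (mem_forms_one_of_mem_invForms hv), hc, smul_one_mul]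
      simp only [contr_eq_zero h hy, mul_zero, Finset.sum_const_zero, smul_zero, zero_add]
      exact Submodule.smul_mem _ _ hy
    | add x _ y _ hx hy => rw [map_add]; exact add_mem hx hy
  | succ n ih =>
    rw [forms_succ] at hx
    induction hx using Submodule.mul_induction_on' with
    | mem_mul_mem v hv y hy =>
      obtain ⟨c, hc⟩ := exists_contr_eq_smul_one h p hv
      rw [contr_mul h (mem_forms_one_of_mem_invForms hv), hc, smul_one_mul]
      refine add_mem (Submodule.smul_mem _ _ (sum_mem fun s _ => ?_)) (Submodule.smul_mem _ _ hy)
      rw [forms_succ]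
      exact Submodule.mul_mem_mul (convOp_mem_invForms h p s hv) (ih s hy)
    | add x _ y _ hx hy => rw [map_add]; exact add_mem hx hy

/-- The coefficient of `e_p` in `θ`. -/
def thetaCoeff (p : Fin 4) : ℂ := if lo p = up p then 1 else 0

lemma contr_theta (p : Fin 4) : contr h p (theta q r) = thetaCoeff p • 1 := by
  rw [theta, map_add, contr_e, contr_e]
  fin_cases p <;> simp [thetaCoeff, lo, up]

/-- The 1-form `θ` is coinvariant. -/
lemma convOp_theta (p s : Fin 4) : convOp h p s (theta q r) = if p = s then theta q r else 0 := by
  -- For `θ = ∑ e_i^i` the coefficient matrices add up to `∑ (S tʲ_i) t^i_k = δ`.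
  have key (y : Fin 4) : coactMat q y 0 p s + coactMat q y 3 p s =
      (if lo y = up y then 1 else 0 : Matrix (Fin 4) (Fin 4) ℂ) p s := by
    rw [← sum_actS_mul_act, Fin.sum_univ_two]
    rfl
  rw [theta, map_add, convOp_e, convOp_e, ← Finset.sum_add_distrib]
  simp only [← add_smul, key]
  by_cases hps : p = s <;> simp [Fin.sum_univ_four, lo, up, hps]

/-- The Lie derivative (up to the counit) along the vector dual to `e_p`: convolution with the
functional `a ↦ ⟨e_p, a ▷ θ⟩`. -/
def lieOp (p : Fin 4) : Omega q r →ₗ[ℂ] Omega q r := convOp h p 0 + convOp h p 3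

omit h in
lemma theta_mem_forms (q : ℂˣ) (r : ℕ) : theta q r ∈ forms q r 1 :=
  mem_forms_one_of_mem_invForms
    (add_mem (Submodule.subset_span ⟨0, rfl⟩) (Submodule.subset_span ⟨3, rfl⟩))

lemma contr_theta_mul (p : Fin 4) (x : Omega q r) :
    contr h p (theta q r * x) = thetaCoeff p • x - theta q r * contr h p x := by
  rw [contr_mul h (theta_mem_forms q r), contr_theta, smul_one_mul]
  simp only [convOp_theta]
  simp [sub_eq_add_neg, add_comm]

/-- Right multiplication by `θ`, unlike left multiplication, makes the convolution operators appear.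
-/
lemma contr_mul_theta (p : Fin 4) {n : ℕ} {x : Omega q r} (hx : x ∈ forms q r n) :
    contr h p (x * theta q r) = (-1 : ℂ) ^ n • lieOp h p x + contr h p x * theta q r := by
  rw [contr_mul h hx, lieOp]
  simp [contr_theta, Fin.sum_univ_four, thetaCoeff, lo, up]

end operators

/-! ### Relations among the convolution operators -/

section relations

variable {q : ℂˣ} {r : ℕ} (h : IsOmegaRep q r (coactT q r) (coactE q r))

include h

/-- The matrix of the coaction of `x` is lower triangular, with middle diagonal entries equal to
`x`. -/
structure IsTriangular (x : Omega q r) : Prop where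
  c01 : convOp h 0 1 x = 0
  c02 : convOp h 0 2 x = 0
  c03 : convOp h 0 3 x = 0
  c12 : convOp h 1 2 x = 0
  c13 : convOp h 1 3 x = 0
  c21 : convOp h 2 1 x = 0
  c23 : convOp h 2 3 x = 0
  c11 : convOp h 1 1 x = x
  c22 : convOp h 2 2 x = x

lemma isTriangular (x : Omega q r) : IsTriangular h x := by
  have hq : (q : ℂ) ≠ 0 := q.ne_zero
  induction x using Omega.induction with
  | algebraMap c => constructor <;> rw [convOp_algebraMap] <;> rfl
  | t i k =>
    constructor <;> fin_cases i <;> simp [convOp_t, act, Fin.sum_univ_two]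
  | e p =>
    constructor <;> fin_cases p <;>
      simp [convOp_e, coactMat, act, actS, lo, up, Fin.sum_univ_four]
  | mul x y hx hy =>
    obtain ⟨_, _, _, _, _, _, _, _, _⟩ := hx
    obtain ⟨_, _, _, _, _, _, _, _, _⟩ := hy
    constructor <;> rw [convOp_mul, Fin.sum_univ_four] <;>
      simp only [*, mul_zero, zero_mul, add_zero, zero_add]
  | add x y hx hy =>
    obtain ⟨_, _, _, _, _, _, _, _, _⟩ := hx
    obtain ⟨_, _, _, _, _, _, _, _, _⟩ := hy
    constructor <;> rw [map_add] <;> simp only [*, add_zero]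

lemma convOp_zero_zero_mul (x y : Omega q r) :
    convOp h 0 0 (x * y) = convOp h 0 0 x * convOp h 0 0 y := by
  rw [convOp_mul, Fin.sum_univ_four, (isTriangular h x).c01, (isTriangular h x).c02,
    (isTriangular h x).c03]
  simp

/-- The relations among the convolution operators, on `x`. The operators `convOp h 0 0` and
`convOp h 3 3` are `K` and `K⁻¹` for the group-like element `K` of `u_q(sl₂)`, `convOp h 1 0` and
`convOp h 2 0` are multiples of the root vectors, and the last relation is the quantum determinant
of the matrix of `L`-operators. -/
structure ConvRel (x : Omega q r) : Prop where
  k_k' : convOp h 0 0 (convOp h 3 3 x) = x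
  k_b : convOp h 0 0 (convOp h 1 0 x) = (q : ℂ) ^ 2 • convOp h 1 0 (convOp h 0 0 x)
  k_nb : convOp h 0 0 (convOp h 3 1 x) = convOp h 2 0 x
  k_nc : convOp h 0 0 (convOp h 3 2 x) = (q : ℂ) ^ 2 • convOp h 1 0 x
  k_m : convOp h 0 0 (convOp h 3 0 x) = (q : ℂ) ^ 2 • convOp h 1 0 (convOp h 2 0 x)

lemma convRel (x : Omega q r) : ConvRel h x := by
  have hq : (q : ℂ) ≠ 0 := q.ne_zero
  induction x using Omega.induction with
  | algebraMap c => constructor <;> simp [convOp_algebraMap]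
  | t i k =>
    constructor <;> fin_cases i <;> simp [convOp_t, act, Fin.sum_univ_two]
    all_goals (match_scalars; simp only [mu]; field_simp)
  | e p =>
    constructor <;> fin_cases p <;>
      simp [convOp_e, coactMat, act, actS, lo, up, Fin.sum_univ_four]
    all_goals first
      | (match_scalars <;> simp only [mu] <;> field_simp)
      | (match_scalars; field_simp)
  | mul x y hx hy =>
    obtain ⟨x1, x2, x3, x4, x5⟩ := hx
    obtain ⟨y1, y2, y3, y4, y5⟩ := hy
    have tri := isTriangular h
    constructor <;>
      simp only [convOp_mul, Fin.sum_univ_four, (tri _).c01, (tri _).c02, (tri _).c03, (tri _).c12,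
        (tri _).c13, (tri _).c21, (tri _).c23, (tri _).c11, (tri _).c22, map_add, zero_mul,
        mul_zero, add_zero, zero_add, x1, x2, x3, x4, x5, y1, y2, y3, y4, y5, smul_mul_assoc,
        mul_smul_comm, smul_add]
    all_goals try abel
  | add x y hx hy =>
    obtain ⟨_, _, _, _, _⟩ := hx
    obtain ⟨_, _, _, _, _⟩ := hy
    constructor <;> simp only [map_add, smul_add, *]

end relations

/-! ### The homotopy -/

section homotopy

variable {q : ℂˣ} {r : ℕ} (h : IsOmegaRep q r (coactT q r) (coactE q r))

lemma pow_apply_of_apply_eq_smul {M : Type*} [AddCommGroup M] [Module ℂ M] {f : Module.End ℂ M}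
    {v : M} {c : ℂ} (hv : f v = c • v) (n : ℕ) : (f ^ n) v = c ^ n • v := by
  induction n with
  | zero => simp
  | succ n ih => rw [pow_succ', Module.End.mul_apply, ih, map_smul, hv, smul_smul, pow_succ]

include h in
lemma convOp_zero_zero_pow (hq : (q : ℂ) ^ r = 1) :
    (convOp h 0 0 : Module.End ℂ (Omega q r)) ^ r = 1 := by
  have hmul (n : ℕ) (x y : Omega q r) : ((convOp h 0 0 : Module.End ℂ (Omega q r)) ^ n) (x * y) =
      ((convOp h 0 0 : Module.End ℂ (Omega q r)) ^ n) x *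
        ((convOp h 0 0 : Module.End ℂ (Omega q r)) ^ n) y := by
    induction n with
    | zero => simp
    | succ n ih => simp only [pow_succ', Module.End.mul_apply, ih, convOp_zero_zero_mul]
  have hone {v : Omega q r} {c : ℂ} (hv : convOp h 0 0 v = c • v) (hc : c ^ r = 1) :
      ((convOp h 0 0 : Module.End ℂ (Omega q r)) ^ r) v = v := by
    rw [pow_apply_of_apply_eq_smul hv, hc, one_smul]
  have hq' : ((q : ℂ)⁻¹) ^ r = 1 := by rw [inv_pow, hq, inv_one]
  ext x
  rw [Module.End.one_apply]
  induction x using Omega.induction with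
  | algebraMap c =>
    refine hone (c := 1) ?_ (one_pow r)
    rw [convOp_algebraMap, if_pos rfl, one_smul]
  | t i k =>
    refine hone (c := if i = 0 then (q : ℂ) else (q : ℂ)⁻¹) ?_ ?_
    · rw [convOp_t]
      fin_cases i <;> simp [Fin.sum_univ_two, act]
    · split_ifs <;> assumption
  | e p =>
    refine hone (c := ![1, (q : ℂ)⁻¹ * (q : ℂ)⁻¹, (q : ℂ) * q, 1] p) ?_ ?_
    · rw [convOp_e]
      fin_cases p <;> simp [Fin.sum_univ_four, coactMat, act, actS, lo, up]
    · fin_cases p <;> simp [mul_pow, hq]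
  | mul x y hx hy => rw [hmul, hx, hy]
  | add x y hx hy => rw [map_add, hx, hy]

/-- The operators on `Ω` that preserve the degree and commute with left and right multiplication by
`θ`. -/
def equivariant (q : ℂˣ) (r : ℕ) : Subalgebra ℂ (Module.End ℂ (Omega q r)) where
  carrier := {f | (∀ x, f (theta q r * x) = theta q r * f x) ∧
    (∀ x, f (x * theta q r) = f x * theta q r) ∧ ∀ n, ∀ x ∈ forms q r n, f x ∈ forms q r n}
  mul_mem' := fun hf hg => ⟨fun x => by rw [Module.End.mul_apply, hg.1, hf.1]; rfl,
    fun x => by rw [Module.End.mul_apply, hg.2.1, hf.2.1]; rfl,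
    fun n x hx => hf.2.2 n _ (hg.2.2 n x hx)⟩
  add_mem' := fun hf hg => ⟨fun x => by simp only [LinearMap.add_apply, hf.1, hg.1, mul_add],
    fun x => by simp only [LinearMap.add_apply, hf.2.1, hg.2.1, add_mul],
    fun n x hx => add_mem (hf.2.2 n x hx) (hg.2.2 n x hx)⟩
  algebraMap_mem' := fun c => ⟨fun x => by simp, fun x => by simp,
    fun n x hx => by simpa using Submodule.smul_mem _ c hx⟩

include h in
lemma convOp_mem_equivariant (p s : Fin 4) : convOp h p s ∈ equivariant q r := by
  refine ⟨fun x => ?_, fun x => ?_, fun n x hx => convOp_mem_forms h n p s hx⟩ <;>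
  · rw [convOp_mul]
    simp [convOp_theta]

lemma d_equivariant {f : Module.End ℂ (Omega q r)} (hf : f ∈ equivariant q r) (n : ℕ)
    (x : Omega q r) : f (d q r n x) = d q r n (f x) := by
  rw [d_apply, d_apply, map_sub, map_smul, hf.1, hf.2.1]

include h in
/-- The Cartan formula. -/
lemma contr_d (p : Fin 4) (n : ℕ) {x : Omega q r} (hx : x ∈ forms q r (n + 1)) :
    contr h p (d q r (n + 1) x) = lieOp h p x - thetaCoeff p • x - d q r n (contr h p x) := by
  have hs : (-1 : ℂ) ^ (n + 1) * (-1) ^ (n + 1) = 1 := by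
    rw [← mul_pow]; norm_num
  rw [d_apply, d_apply, map_sub, map_smul, contr_mul_theta h p hx, contr_theta_mul, smul_add,
    smul_smul, hs, pow_succ]
  module

include h in
lemma contr_d_zero (p : Fin 4) {x : Omega q r} (hx : x ∈ forms q r 0) :
    contr h p (d q r 0 x) = lieOp h p x - thetaCoeff p • x := by
  rw [d_apply, map_sub, map_smul, contr_mul_theta h p hx, contr_theta_mul, contr_eq_zero h hx]
  simp

include h in
/-- The difference `lieOp h 0 - 1` is a combination of `lieOp h p` for `θ`-trace-free vectors. -/
lemma exists_conv_sub_one (hodd : Odd r) (hq : (q : ℂ) ^ r = 1) :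
    ∃ U ∈ equivariant q r, ∃ V ∈ equivariant q r,
      lieOp h 0 - 1 = U * (lieOp h 0 - lieOp h 3) + V * lieOp h 2 := by
  -- With `K = convOp h 0 0`, the determinant relation gives `K² - 1` as a combination, and
  -- `K - 1 = K ^ (r + 1) - 1` is a multiple of `K² - 1` as `r` is odd.
  let k : Module.End ℂ (Omega q r) := convOp h 0 0
  let b : Module.End ℂ (Omega q r) := convOp h 1 0
  obtain ⟨s, hs⟩ := hodd
  have hk : k ∈ equivariant q r := convOp_mem_equivariant h 0 0
  have hb : b ∈ equivariant q r := convOp_mem_equivariant h 1 0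
  have hP : (∑ j ∈ Finset.range (s + 1), (k ^ 2) ^ j) ∈ equivariant q r :=
    sum_mem fun j _ => pow_mem (pow_mem hk 2) j
  have h0 : lieOp h 0 = k := by
    ext x
    simp [lieOp, (isTriangular h x).c03, k]
  have h2 : lieOp h 2 = (convOp h 2 0 : Module.End ℂ (Omega q r)) := by
    ext x
    simp [lieOp, (isTriangular h x).c23]
  have h3 : k * lieOp h 3 = (q : ℂ) ^ 2 • (b * lieOp h 2) + 1 := by
    ext x
    rw [h2]
    simp only [Module.End.mul_apply, lieOp, LinearMap.add_apply, map_add, LinearMap.smul_apply,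
      Module.End.one_apply, k, b, (convRel h x).k_m, (convRel h x).k_k']
  refine ⟨(∑ j ∈ Finset.range (s + 1), (k ^ 2) ^ j) * k, mul_mem hP hk,
    (∑ j ∈ Finset.range (s + 1), (k ^ 2) ^ j) * ((q : ℂ) ^ 2 • b),
    mul_mem hP (Subalgebra.smul_mem _ hb _), ?_⟩
  have hgeom := geom_sum_mul (k ^ 2) (s + 1)
  have hpow : (k ^ 2) ^ (s + 1) = k := by
    rw [← pow_mul, show 2 * (s + 1) = r + 1 by omega, pow_succ, convOp_zero_zero_pow h hq, one_mul]
  rw [hpow] at hgeom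
  rw [mul_assoc, mul_assoc, ← mul_add, h0, mul_sub, h3, ← hgeom, smul_mul_assoc, sq]
  congr 1
  abel

include h in
/-- There is a contraction `J` with `J θ + θ J = 1` and `J d + d J = 0`. -/
theorem exists_homotopy (hodd : Odd r) (hq : (q : ℂ) ^ r = 1) :
    ∃ J : Omega q r →ₗ[ℂ] Omega q r,
      (∀ n, ∀ x ∈ forms q r (n + 1), J x ∈ forms q r n) ∧
      (∀ x ∈ forms q r 0, J x = 0) ∧
      (∀ x, J (theta q r * x) = x - theta q r * J x) ∧
      (∀ n, ∀ x ∈ forms q r (n + 1), J (d q r (n + 1) x) = -d q r n (J x)) ∧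
      ∀ x ∈ forms q r 0, J (d q r 0 x) = 0 := by
  obtain ⟨U, hU, V, hV, hUV⟩ := exists_conv_sub_one h hodd hq
  have hUV' (x : Omega q r) :
      lieOp h 0 x - x - (U (lieOp h 0 x - lieOp h 3 x) + V (lieOp h 2 x)) = 0 :=
    sub_eq_zero.2 (LinearMap.congr_fun hUV x)
  have c0 : thetaCoeff 0 = 1 := rfl
  have c2 : thetaCoeff 2 = 0 := rfl
  have c3 : thetaCoeff 3 = 1 := rfl
  refine ⟨contr h 0 - (U ∘ₗ (contr h 0 - contr h 3) + V ∘ₗ contr h 2), fun n x hx => ?_,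
    fun x hx => ?_, fun x => ?_, fun n x hx => ?_, fun x hx => ?_⟩ <;>
    simp only [LinearMap.sub_apply, LinearMap.add_apply, LinearMap.comp_apply]
  · exact sub_mem (contr_mem_forms h n 0 hx) (add_mem (hU.2.2 n _ (sub_mem
      (contr_mem_forms h n 0 hx) (contr_mem_forms h n 3 hx)))
        (hV.2.2 n _ (contr_mem_forms h n 2 hx)))
  · simp only [contr_eq_zero h hx, sub_zero, map_zero, add_zero]
  · simp only [contr_theta_mul, c0, c2, c3, one_smul, zero_smul, zero_sub, sub_sub_sub_cancel_left,
      ← mul_sub, map_neg, hU.1, hV.1]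
    rw [← neg_sub (contr h 0 x) (contr h 3 x), map_neg, mul_neg, mul_sub, mul_add]
    abel
  · have e := hUV' x
    simp only [contr_d h _ n hx, c0, c2, c3, one_smul, zero_smul, sub_zero]
    simp only [map_sub, map_add, d_equivariant hU, d_equivariant hV] at e ⊢
    rw [← sub_eq_zero, ← e]
    abel
  · have e := hUV' x
    simp only [contr_d_zero h _ hx, c0, c2, c3, one_smul, zero_smul, sub_zero]
    simp only [map_sub] at e ⊢
    rw [← e]
    abel

end homotopy

/-! ### The quadratic relations and the vanishing of 5-forms -/

/-- As `A₂ = id - Ψ`, its kernel consists of the tensors fixed by `Ψ`. -/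
lemma sum_smul_e_mul_e_eq_zero (q : ℂˣ) (r : ℕ) (c : Matrix (Fin 4) (Fin 4) ℂ)
    (hc : ∀ p s, ∑ p', ∑ s', coactMat q s p' p s' * c p' s' = c p s) :
    ∑ p, ∑ s, c p s • (e q r p * e q r s) = 0 := by
  have hx : antisym q 2 (fun w => c (w 0) (w 1)) = 0 := by
    refine tens_ext fun p => tens_ext fun s => ?_
    have h1 : antisym q 1 = LinearMap.id := by
      refine LinearMap.ext fun x => tens_ext fun _ => rfl
    rw [antisym, LinearMap.comp_apply, slice_idTensor, h1, LinearMap.id_apply, braidedInt,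
      LinearMap.sub_apply, map_sub, map_sub, LinearMap.comp_apply, slice_slice_psi12]
    funext v
    have := hc p s
    simp only [braidedInt, Pi.sub_apply, Finset.sum_apply, Pi.smul_apply, smul_eq_mul,
      LinearMap.id_apply, braid_apply, map_zero, Pi.zero_apply, slice_idTensor]
    exact sub_eq_zero.2 this.symm
  have h := wordEval_e_eq_zero q r 2 hx
  simp only [wordEval_succ, wordEval_zero, Finset.mul_sum, mul_smul_comm, mul_one] at h
  exact h

/-- The relations in `ker A₂`, combined with arbitrary coefficients. -/
lemma e_quadratic (q : ℂˣ) (r : ℕ) (x : Fin 10 → ℂ) :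
    x 0 • (e q r 0 * e q r 0 - mu q • (e q r 1 * e q r 2)) +
    x 1 • (e q r 1 * e q r 0 + (q : ℂ)⁻¹ ^ 2 • (e q r 0 * e q r 1) -
      ((q : ℂ)⁻¹ ^ 2 * mu q) • (e q r 1 * e q r 3)) +
    x 2 • (e q r 1 * e q r 1) +
    x 3 • (e q r 2 * e q r 0 + (q : ℂ) ^ 2 • (e q r 0 * e q r 2) + mu q • (e q r 2 * e q r 3)) +
    x 4 • (e q r 2 * e q r 1 + e q r 1 * e q r 2) +
    x 5 • (e q r 2 * e q r 2) +
    x 6 • (e q r 3 * e q r 0 + e q r 0 * e q r 3 + mu q • (e q r 1 * e q r 2)) +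
    x 7 • (e q r 3 * e q r 1 + e q r 1 * e q r 3) +
    x 8 • (e q r 3 * e q r 2 + e q r 2 * e q r 3) +
    x 9 • (e q r 3 * e q r 3) = 0 := by
  have hq : (q : ℂ) ≠ 0 := q.ne_zero
  rw [← sum_smul_e_mul_e_eq_zero q r
    !![x 0, (q : ℂ)⁻¹ ^ 2 * x 1, (q : ℂ) ^ 2 * x 3, x 6;
      x 1, x 2, x 4 + mu q * x 6 - mu q * x 0, x 7 - (q : ℂ)⁻¹ ^ 2 * mu q * x 1;
      x 3, x 4, x 5, x 8 + mu q * x 3;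
      x 6, x 7, x 8, x 9]]
  · simp [Fin.sum_univ_four]
    module
  · intro p s
    fin_cases p <;> fin_cases s <;> simp [Fin.sum_univ_four, coactMat, act, actS, lo, up]
    all_goals first
      | (simp only [mu]; field_simp; ring1)
      | (field_simp; simp)

/-- The span of `e_b, e_c, e_d`; these anticommute and square to zero. -/
def formsE (q : ℂˣ) (r : ℕ) : Submodule ℂ (Omega q r) :=
  Submodule.span ℂ {e q r 1, e q r 2, e q r 3}

/-- The ten quadratic relations of `Λ`. -/
lemma e_relation (q : ℂˣ) (r : ℕ) (i : Fin 10) :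
    ![e q r 0 * e q r 0 - mu q • (e q r 1 * e q r 2),
      e q r 1 * e q r 0 + (q : ℂ)⁻¹ ^ 2 • (e q r 0 * e q r 1) -
        ((q : ℂ)⁻¹ ^ 2 * mu q) • (e q r 1 * e q r 3),
      e q r 1 * e q r 1,
      e q r 2 * e q r 0 + (q : ℂ) ^ 2 • (e q r 0 * e q r 2) + mu q • (e q r 2 * e q r 3),
      e q r 2 * e q r 1 + e q r 1 * e q r 2,
      e q r 2 * e q r 2,
      e q r 3 * e q r 0 + e q r 0 * e q r 3 + mu q • (e q r 1 * e q r 2),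
      e q r 3 * e q r 1 + e q r 1 * e q r 3,
      e q r 3 * e q r 2 + e q r 2 * e q r 3,
      e q r 3 * e q r 3] i = 0 := by
  have h := e_quadratic q r (Pi.single i 1)
  fin_cases i <;> simpa using h

lemma mem_formsE (q : ℂˣ) (r : ℕ) :
    e q r 1 ∈ formsE q r ∧ e q r 2 ∈ formsE q r ∧ e q r 3 ∈ formsE q r :=
  ⟨Submodule.subset_span (by simp), Submodule.subset_span (by simp),
    Submodule.subset_span (by simp)⟩

lemma span_mul_formsE_le (q : ℂˣ) (r : ℕ) :
    formsE q r * Submodule.span ℂ {e q r 0} ≤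
      Submodule.span ℂ {e q r 0} * formsE q r ⊔ formsE q r * formsE q r := by
  have ha : e q r 0 ∈ Submodule.span ℂ {e q r 0} := Submodule.mem_span_singleton_self _
  obtain ⟨h1, h2, h3⟩ := mem_formsE q r
  have r1 : e q r 1 * e q r 0 + (q : ℂ)⁻¹ ^ 2 • (e q r 0 * e q r 1) -
        ((q : ℂ)⁻¹ ^ 2 * mu q) • (e q r 1 * e q r 3) = 0 := e_relation q r 1
  have r2 : e q r 2 * e q r 0 + (q : ℂ) ^ 2 • (e q r 0 * e q r 2) +
      mu q • (e q r 2 * e q r 3) = 0 :=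
    e_relation q r 3
  have r3 : e q r 3 * e q r 0 + e q r 0 * e q r 3 + mu q • (e q r 1 * e q r 2) = 0 :=
    e_relation q r 6
  rw [formsE, Submodule.span_mul_span, Submodule.span_le, ← formsE]
  rintro _ ⟨x, hx, y, rfl, rfl⟩
  rcases hx with rfl | rfl | rfl
  · have : e q r 1 * e q r 0 = -(q : ℂ)⁻¹ ^ 2 • (e q r 0 * e q r 1) +
        ((q : ℂ)⁻¹ ^ 2 * mu q) • (e q r 1 * e q r 3) := by
      rw [← sub_eq_zero, ← r1]; module
    change e q r 1 * e q r 0 ∈ _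
    rw [this]
    exact Submodule.add_mem_sup (Submodule.smul_mem _ _ (Submodule.mul_mem_mul ha h1))
      (Submodule.smul_mem _ _ (Submodule.mul_mem_mul h1 h3))
  · have : e q r 2 * e q r 0 = -(q : ℂ) ^ 2 • (e q r 0 * e q r 2) +
        (-mu q) • (e q r 2 * e q r 3) := by
      rw [← sub_eq_zero, ← r2]; module
    change e q r 2 * e q r 0 ∈ _
    rw [this]
    exact Submodule.add_mem_sup (Submodule.smul_mem _ _ (Submodule.mul_mem_mul ha h2))
      (Submodule.smul_mem _ _ (Submodule.mul_mem_mul h2 h3))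
  · have : e q r 3 * e q r 0 = (-1 : ℂ) • (e q r 0 * e q r 3) +
        (-mu q) • (e q r 1 * e q r 2) := by
      rw [← sub_eq_zero, ← r3]; module
    change e q r 3 * e q r 0 ∈ _
    rw [this]
    exact Submodule.add_mem_sup (Submodule.smul_mem _ _ (Submodule.mul_mem_mul ha h3))
      (Submodule.smul_mem _ _ (Submodule.mul_mem_mul h1 h2))

lemma span_mul_span_le (q : ℂˣ) (r : ℕ) :
    Submodule.span ℂ {e q r 0} * Submodule.span ℂ {e q r 0} ≤ formsE q r * formsE q r := by
  obtain ⟨h1, h2, -⟩ := mem_formsE q r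
  have r0 : e q r 0 * e q r 0 - mu q • (e q r 1 * e q r 2) = 0 := e_relation q r 0
  rw [Submodule.span_mul_span, Submodule.span_le]
  rintro _ ⟨_, rfl, _, rfl, rfl⟩
  change e q r 0 * e q r 0 ∈ _
  rw [sub_eq_zero.1 r0]
  exact Submodule.smul_mem _ _ (Submodule.mul_mem_mul h1 h2)

/-- The relations move `e_a` to the left, where it occurs at most once. -/
lemma invForms_pow_succ_le (q : ℂˣ) (r n : ℕ) : invForms q r ^ (n + 1) ≤
    formsE q r ^ (n + 1) ⊔ Submodule.span ℂ {e q r 0} * formsE q r ^ n := by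
  have h0 : invForms q r ≤ formsE q r ⊔ Submodule.span ℂ {e q r 0} := by
    obtain ⟨h1, h2, h3⟩ := mem_formsE q r
    rw [invForms, Submodule.span_le]
    rintro _ ⟨p, rfl⟩
    fin_cases p
    · exact Submodule.mem_sup_right (Submodule.mem_span_singleton_self _)
    · exact Submodule.mem_sup_left h1
    · exact Submodule.mem_sup_left h2
    · exact Submodule.mem_sup_left h3
  induction n with
  | zero => simpa using h0
  | succ n ih =>
    rw [pow_succ']
    refine (mul_le_mul' h0 ih).trans ?_
    rw [Submodule.sup_mul, Submodule.mul_sup, Submodule.mul_sup, ← pow_succ', ← mul_assoc,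
      ← mul_assoc]
    have e2 : formsE q r * formsE q r * formsE q r ^ n = formsE q r ^ (n + 1 + 1) := by
      rw [mul_assoc, ← pow_succ', ← pow_succ']
    refine sup_le (sup_le le_sup_left ?_) (sup_le le_sup_right ?_)
    · refine (mul_le_mul' (span_mul_formsE_le q r) le_rfl).trans ?_
      rw [Submodule.sup_mul, mul_assoc, ← pow_succ', e2]
      exact sup_le le_sup_right le_sup_left
    · refine (mul_le_mul' (span_mul_span_le q r) le_rfl).trans ?_
      rw [e2]
      exact le_sup_left

lemma formsE_pow_four (q : ℂˣ) (r : ℕ) : formsE q r ^ 4 = ⊥ := by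
  have bb : e q r 1 * e q r 1 = 0 := e_relation q r 2
  have cc : e q r 2 * e q r 2 = 0 := e_relation q r 5
  have dd : e q r 3 * e q r 3 = 0 := e_relation q r 9
  have cb : e q r 2 * e q r 1 = -(e q r 1 * e q r 2) :=
    eq_neg_of_add_eq_zero_left (e_relation q r 4)
  have db : e q r 3 * e q r 1 = -(e q r 1 * e q r 3) :=
    eq_neg_of_add_eq_zero_left (e_relation q r 7)
  have dc : e q r 3 * e q r 2 = -(e q r 2 * e q r 3) :=
    eq_neg_of_add_eq_zero_left (e_relation q r 8)
  have assoc {u v w : Omega q r} (h : u * v = w) (z : Omega q r) : u * (v * z) = w * z := by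
    rw [← mul_assoc, h]
  have h2 : formsE q r * formsE q r ≤
      Submodule.span ℂ {e q r 1 * e q r 2, e q r 1 * e q r 3, e q r 2 * e q r 3} := by
    have h12 : e q r 1 * e q r 2 ∈ Submodule.span ℂ
      {e q r 1 * e q r 2, e q r 1 * e q r 3, e q r 2 * e q r 3} := Submodule.subset_span (by simp)
    have h13 : e q r 1 * e q r 3 ∈ Submodule.span ℂ
      {e q r 1 * e q r 2, e q r 1 * e q r 3, e q r 2 * e q r 3} := Submodule.subset_span (by simp)
    have h23 : e q r 2 * e q r 3 ∈ Submodule.span ℂ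
      {e q r 1 * e q r 2, e q r 1 * e q r 3, e q r 2 * e q r 3} := Submodule.subset_span (by simp)
    rw [formsE, Submodule.span_mul_span, Submodule.span_le]
    rintro _ ⟨x, rfl | rfl | rfl, y, rfl | rfl | rfl, rfl⟩ <;>
      simp only [bb, cc, dd, cb, db, dc, SetLike.mem_coe, zero_mem, neg_mem_iff, h12, h13, h23]
  have h3 : formsE q r *
        Submodule.span ℂ {e q r 1 * e q r 2, e q r 1 * e q r 3, e q r 2 * e q r 3} ≤
      Submodule.span ℂ {e q r 1 * (e q r 2 * e q r 3)} := by
    have h123 := Submodule.mem_span_singleton_self (R := ℂ) (e q r 1 * (e q r 2 * e q r 3))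
    rw [formsE, Submodule.span_mul_span, Submodule.span_le]
    rintro _ ⟨x, rfl | rfl | rfl, y, rfl | rfl | rfl, rfl⟩ <;>
      simp only [cc, dd, dc, assoc bb, assoc cc, assoc cb, assoc db, assoc dc, neg_mul,
        mul_neg, neg_neg, zero_mul, mul_zero, mul_assoc, neg_zero, SetLike.mem_coe,
        zero_mem, neg_mem_iff, h123]
  have h4 : formsE q r * Submodule.span ℂ {e q r 1 * (e q r 2 * e q r 3)} ≤ ⊥ := by
    rw [formsE, Submodule.span_mul_span, Submodule.span_le]
    rintro _ ⟨x, rfl | rfl | rfl, y, rfl, rfl⟩ <;>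
      simp [dd, assoc bb, assoc cc, assoc cb, assoc db, assoc dc, mul_assoc]
  rw [eq_bot_iff]
  refine le_trans (le_of_eq ?_) ((mul_le_mul' le_rfl ((mul_le_mul' le_rfl h2).trans h3)).trans h4)
  rw [pow_succ', pow_succ', sq]

/-- There are no 5-forms. -/
lemma forms_five (q : ℂˣ) (r : ℕ) : forms q r 5 = ⊥ := by
  have h5 : formsE q r ^ 5 = ⊥ := by rw [pow_succ, formsE_pow_four, Submodule.bot_mul]
  have h : invForms q r ^ 5 = ⊥ := by
    have := invForms_pow_succ_le q r 4
    rwa [h5, formsE_pow_four, Submodule.mul_bot, bot_sup_eq, le_bot_iff] at this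
  rw [forms, h, Submodule.bot_mul]

/-! ### Cohomology -/

section cohomology

variable {q : ℂˣ} {r : ℕ}

lemma thetaH_mk (n : ℕ) (x : closed q r n) :
    thetaH q r n (Submodule.Quotient.mk x) = Submodule.Quotient.mk (thetaClosed q r n x) := rfl

lemma thetaH_mk_eq_zero (n : ℕ) (x : closed q r n) :
    thetaH q r n (Submodule.Quotient.mk x) = 0 ↔
      theta q r * (x : Omega q r) ∈ exact q r (n + 1) := by
  rw [thetaH_mk, Submodule.Quotient.mk_eq_zero]
  rfl

lemma thetaH_comp_thetaH (q : ℂˣ) (r n : ℕ) : thetaH q r (n + 1) ∘ₗ thetaH q r n = 0 := by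
  refine LinearMap.ext fun y => ?_
  obtain ⟨x, rfl⟩ := Submodule.Quotient.mk_surjective _ y
  rw [LinearMap.comp_apply, LinearMap.zero_apply, thetaH_mk, thetaH_mk_eq_zero]
  change theta q r * (theta q r * (x : Omega q r)) ∈ _
  rw [← mul_assoc, theta_mul_theta, zero_mul]
  exact zero_mem _

variable {J : Omega q r →ₗ[ℂ] Omega q r}
  (hJ : ∀ n, ∀ x ∈ forms q r (n + 1), J x ∈ forms q r n)
  (hJ0 : ∀ x ∈ forms q r 0, J x = 0)
  (hJθ : ∀ x, J (theta q r * x) = x - theta q r * J x)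
  (hJd : ∀ n, ∀ x ∈ forms q r (n + 1), J (d q r (n + 1) x) = -d q r n (J x))
  (hJd0 : ∀ x ∈ forms q r 0, J (d q r 0 x) = 0)

include hJ0 hJθ hJd0 in
lemma thetaH_zero_injective : Function.Injective (thetaH q r 0) := by
  rw [injective_iff_map_eq_zero]
  intro y hy
  obtain ⟨x, rfl⟩ := Submodule.Quotient.mk_surjective _ y
  obtain ⟨z, hz, hzx⟩ := (thetaH_mk_eq_zero 0 x).1 hy
  have h := hJθ (x : Omega q r)
  rw [← hzx, hJd0 z hz, hJ0 x x.2.1, mul_zero, sub_zero] at h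
  rw [show x = 0 from Subtype.ext h.symm, Submodule.Quotient.mk_zero]

include hJ hJθ hJd in
/-- If `θ x = d z` for a closed form `x`, then `x = J θ x + θ J x = -d (J z) + θ J x` with `J x`
closed. -/
lemma exists_thetaH_eq (n : ℕ) (x : closed q r (n + 1))
    (hx : theta q r * (x : Omega q r) ∈ exact q r (n + 2)) :
    ∃ y, thetaH q r n y = Submodule.Quotient.mk x := by
  obtain ⟨z, hz, hzx⟩ := hx
  have hd : d q r (n + 1) (x : Omega q r) = 0 := x.2.2
  refine ⟨Submodule.Quotient.mk ⟨J x, hJ n x x.2.1, ?_⟩, ?_⟩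
  · have h := hJd n x x.2.1
    rw [hd, map_zero] at h
    exact neg_eq_zero.1 h.symm
  · rw [thetaH_mk, Submodule.Quotient.eq]
    change theta q r * J x - x ∈ exact q r (n + 1)
    have h := hJθ (x : Omega q r)
    rw [← hzx, hJd n z hz] at h
    refine ⟨J z, hJ n z hz, ?_⟩
    rw [← neg_inj, h, neg_sub]

include hJ hJθ hJd in
lemma thetaH_exact (n : ℕ) : Function.Exact (thetaH q r n) (thetaH q r (n + 1)) := by
  intro y
  constructor
  · intro hy
    obtain ⟨x, rfl⟩ := Submodule.Quotient.mk_surjective _ y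
    exact exists_thetaH_eq hJ hJθ hJd n x ((thetaH_mk_eq_zero _ x).1 hy)
  · rintro ⟨z, rfl⟩
    exact LinearMap.congr_fun (thetaH_comp_thetaH q r n) z

end cohomology

end

end QSL2

theorem proposition3p5 (r : ℕ) (hr : r = 3 ∨ r = 5 ∨ r = 7) (q : ℂˣ) (hq : IsPrimitiveRoot q r) :
    (∀ n : ℕ, QSL2.thetaH q r (n + 1) ∘ₗ QSL2.thetaH q r n = 0) ∧
    Function.Injective (QSL2.thetaH q r 0) ∧
    Function.Exact (QSL2.thetaH q r 0) (QSL2.thetaH q r 1) ∧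
    Function.Exact (QSL2.thetaH q r 1) (QSL2.thetaH q r 2) ∧
    Function.Exact (QSL2.thetaH q r 2) (QSL2.thetaH q r 3) ∧
    Function.Surjective (QSL2.thetaH q r 3) := by
  have hr1 : 1 < r := by omega
  have hodd : Odd r := by rcases hr with rfl | rfl | rfl <;> decide
  have hq' : IsPrimitiveRoot (q : ℂ) r := IsPrimitiveRoot.coe_units_iff.2 hq
  obtain ⟨J, hJ, hJ0, hJθ, hJd, hJd0⟩ :=
    QSL2.exists_homotopy (QSL2.isOmegaRep_coact hr1 hodd hq') hodd hq'.pow_eq_one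
  refine ⟨QSL2.thetaH_comp_thetaH q r, QSL2.thetaH_zero_injective hJ0 hJθ hJd0,
    QSL2.thetaH_exact hJ hJθ hJd 0, QSL2.thetaH_exact hJ hJθ hJd 1,
    QSL2.thetaH_exact hJ hJθ hJd 2, fun y => ?_⟩
  obtain ⟨x, rfl⟩ := Submodule.Quotient.mk_surjective _ y
  refine QSL2.exists_thetaH_eq hJ hJθ hJd 3 x ?_
  have h5 := QSL2.theta_mul_mem q r 4 x.2.1
  rw [QSL2.forms_five, Submodule.mem_bot] at h5
  rw [h5]
  exact zero_mem _
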